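/- Let $X$ be a finite set. A cost function is a map $\rho : X\times X\to\mathbb{R}_{\ge 0}\cup\{\infty\}$ with $\rho(x,x)=0$ for all $x\in X$. For a sample $S\in X^k$ let $\mathcal{C}_\rho(S)$ be the set of all $S'\in X^k$ with $\frac1k\sum_{i=1}^k\rho(S_i,S'_i)\le 1$. For a distribution $\mathcal{D}$ on $X$ let $\mathcal{C}_\rho(\mathcal{D})$ be the set of all distributions $\mathcal{D}'$ on $X$ for which some coupling of $x\sim\mathcal{D}$ and $x'\sim\mathcal{D}'$ satisfies $\mathbb{E}[\rho(x,x')]\le 1$. For a (possibly randomized) $f:X^k\to\{0,1\}$, writing $f(S)$ also for the probability that $f$ outputs $1$ on input $S$, let $$\mathrm{Adaptive\text{-}Max}_\rho(f,\mathcal{D})=\mathbb{E}_{S\sim\mathcal{D}^k}\Big[\sup_{S'\in\mathcal{C}_\rho(S)}f(S')\Big],\qquad \mathrm{Oblivious\text{-}Max}_\rho(f,\mathcal{D})=\sup_{\mathcal{D}'\in\mathcal{C}_\rho(\mathcal{D})}\mathbb{E}_{S'\sim(\mathcal{D}')^k}[f(S')].$$ For $m\ge n$ let $\Phi_{m\to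 n}:X^m\to X^n$ be the randomized map that returns a sequence of $n$ points drawn uniformly without replacement from its input. Theorem. There is a polynomial $P$ in three variables such that the following holds for every finite set $X$, every set $Y$, every $n\in\mathbb{N}$, every (possibly randomized) algorithm $A:X^n\to Y$, every $\varepsilon>0$, every cost function $\rho$ on $X$, and every integer $m\ge P(n,\ln|X|,1/\varepsilon)$. We have $m\ge n$, and $A$ in the presence of the $\rho$-oblivious adversary is $\varepsilon$-equivalent to $A'=A\circ\Phi_{m\to n}$ in the presence of the $\rho$-adaptive adversary; that is, for every test function $T:Y\to\{0,1\}$ and every distribution $\mathcal{D}$ on $X$, $$\big|\mathrm{Oblivious\text{-}Max}_\rho(T\circ A,\mathcal{D})-\mathrm{Adaptive\text{-}Max}_\rho(T\circ A',\mathcal{D})\big|\le\varepsilon.$$ -/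

import Mathlib

open scoped ENNReal

noncomputable section

namespace Adversary

/-- A cost function on `X`: `ρ x y ∈ [0, ∞]` is the cost of corrupting `x` to `y`, and leaving a
point unchanged is free. -/
structure CostFunction (X : Type*) where
  cost : X → X → ℝ≥0∞
  cost_self : ∀ x, cost x x = 0

/-- A (possibly randomized) algorithm taking `n` points of `X` to an output in `Y`: to each sample
it assigns the distribution of its output. A deterministic algorithm `a : (Fin n → X) → Y` is
`fun S => PMF.pure (a S)`. -/
abbrev Algorithm (X : Type*) (n : ℕ) (Y : Type*) : Type _ := (Fin n → X) → PMF Y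

/-- The algorithm `T ∘ A`: run `A` and apply the test `T` to its output. -/
def Algorithm.test {X Y : Type*} {n : ℕ} (T : Y → Bool) (A : Algorithm X n Y) :
    Algorithm X n Bool :=
  fun S => (A S).map T

/-- The probability, over the internal randomness of `f`, that `f` outputs `1` on the sample `S`.
For a deterministic `f` this is the value `f S ∈ {0, 1}`. -/
def Algorithm.accept {X : Type*} {n : ℕ} (f : Algorithm X n Bool) (S : Fin n → X) : ℝ :=
  (f S true).toReal

/-- Expectation of a real function under a distribution on a finite type. -/
def expect {α : Type*} [Fintype α] (μ : PMF α) (g : α → ℝ) : ℝ :=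
  ∑ a, (μ a).toReal * g a

/-- The product distribution `D ^ n` of `n` independent draws from `D`. -/
def iid {X : Type*} [Fintype X] (D : PMF X) (n : ℕ) : PMF (Fin n → X) :=
  PMF.ofFintype (fun S => ∏ i, D (S i)) (by
    have hD : ∑ x, D x = 1 := by rw [← tsum_fintype (L := .unconditional X)]; exact D.tsum_coe
    rw [← Fintype.prod_sum (fun (_ : Fin n) (x : X) => D x)]
    simp [hD])

/-- The legal corruptions of a sample: those whose average cost is at most `1`. -/
def sampleCorruptions {X : Type*} {n : ℕ} (ρ : CostFunction X) (S : Fin n → X) :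
    Set (Fin n → X) :=
  {S' | (n : ℝ≥0∞)⁻¹ * ∑ i, ρ.cost (S i) (S' i) ≤ 1}

/-- The legal corruptions of a distribution `D`: those `D'` for which there is a coupling `π` of
`x ∼ D` and `x' ∼ D'` with expected cost at most `1`. -/
def distCorruptions {X : Type*} [Fintype X] (ρ : CostFunction X) (D : PMF X) : Set (PMF X) :=
  {D' | ∃ π : PMF (X × X), π.map Prod.fst = D ∧ π.map Prod.snd = D' ∧
    ∑ p, π p * ρ.cost p.1 p.2 ≤ 1}

/-- Max success probability of `f` in the presence of the `ρ`-adaptive adversary. The supremum is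
over a nonempty set (it contains `S`) of numbers in `[0, 1]`. The adversary sees the sample but not
the internal randomness of `f`. -/
def adaptiveMax {X : Type*} [Fintype X] {n : ℕ} (ρ : CostFunction X) (f : Algorithm X n Bool)
    (D : PMF X) : ℝ :=
  expect (iid D n) (fun S => ⨆ S' : sampleCorruptions ρ S, f.accept S')

/-- Max success probability of `f` in the presence of the `ρ`-oblivious adversary. The supremum is
over a nonempty set (it contains `D`) of numbers in `[0, 1]`. -/
def obliviousMax {X : Type*} [Fintype X] {n : ℕ} (ρ : CostFunction X) (f : Algorithm X n Bool)
    (D : PMF X) : ℝ :=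
  ⨆ D' : distCorruptions ρ D, expect (iid (D' : PMF X) n) f.accept

/-- `A` in the presence of the `ρ`-oblivious adversary is `ε`-equivalent to `A'` in the presence of
the `ρ`-adaptive adversary. -/
def EpsEquivalent {X Y : Type*} [Fintype X] {n m : ℕ} (ρ : CostFunction X) (ε : ℝ)
    (A : Algorithm X n Y) (A' : Algorithm X m Y) : Prop :=
  ∀ (T : Y → Bool) (D : PMF X), |obliviousMax ρ (A.test T) D - adaptiveMax ρ (A'.test T) D| ≤ ε

/-- The subsampling filter `Φ_{m → n}`: draw `n` of the `m` points of `S` one after another,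
uniformly without replacement, i.e. read `S` along a uniformly random injection `[n] → [m]`. -/
def subsample {X : Type*} {n m : ℕ} (h : n ≤ m) : Algorithm X m (Fin n → X) :=
  fun S =>
    haveI : Nonempty (Fin n ↪ Fin m) := ⟨Fin.castLEEmb h⟩
    (PMF.uniformOfFintype (Fin n ↪ Fin m)).map (fun σ => S ∘ σ)

/-- The algorithm `A ∘ Φ_{m → n}`: subsample, then run `A` (with independent randomness). -/
def Algorithm.afterSubsample {X Y : Type*} {n m : ℕ} (A : Algorithm X n Y) (h : n ≤ m) :
    Algorithm X m Y :=
  fun S => (subsample h S).bind A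

end Adversary

end

/-!
Subsampling turns an adaptive adversary into an oblivious one. Write `f = T ∘ A`, let `F` be `f`
applied to a random subsample, and let `L = log |X|`.

*Oblivious to adaptive* (`obliviousMax_le_adaptiveMax_add`). The adaptive adversary corrupts each
sample point independently according to the coupling used by the oblivious one. The coupling is
first modified, at a small cost in total variation, so that the cost is bounded and has mean
strictly below `1`; then Chebyshev's inequality keeps the average cost below `1` with high
probability, and a subsample of an i.i.d. sample is i.i.d.

*Adaptive to oblivious* (`adaptiveMax_le_obliviousMax_add`). Permute the indices at random, so that
the pairs `(S i, Z i)` of original and corrupted points become exchangeable, and condition on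
`Z 0, …, Z (t - 1)`.

* The total correlation of the next `n` points `Z t, …, Z (t + n - 1)`, summed over `t < R`,
  telescopes to at most `n² L`. So for some `t < R` these points are, given the past, almost
  independent draws from one conditional distribution (`sum_mul_block_le`).
* The past carries at most `t L` nats about the independent points `S t, …, S (m - 1)`, hence at
  most `t L / (m - t)` about `S t`, whose conditional law is therefore still close to `D`
  (`sum_abs_law_initial_sub_le`).
* The total cost is at most `m` surely, so for every value of the past the conditional expected cost
  of moving `S t` to `Z t` is at most `m / (m - t)` (`sum_conditional_cost_le`).

So the conditional law of `Z t` is close to a legal corruption of `D`, the oblivious adversary can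
play it, and averaging over the past gives the bound. Closeness is measured in `L¹` and controlled
by relative entropy through a form of Pinsker's inequality (`sq_sum_abs_law_sub_le`).
-/

namespace Adversary

/-! ### Entropy on a finite probability space -/

section Entropy

variable {Ω α β : Type*} [Fintype Ω]

open scoped Classical in
/-- The law of the random variable `Y` on the finite space `Ω` with weights `w`, as a real-valued
mass function. -/
noncomputable def law (w : Ω → ℝ) (Y : Ω → α) (a : α) : ℝ :=
  ∑ ω, if Y ω = a then w ω else 0

/-- The Shannon entropy (in nats) of `Y`, written as the expectation of `-log` of the mass of the
observed value. In this form entropy inequalities can be checked pointwise in `ω`. -/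
noncomputable def entropy (w : Ω → ℝ) (Y : Ω → α) : ℝ :=
  -∑ ω, w ω * Real.log (law w Y (Y ω))

lemma law_nonneg {w : Ω → ℝ} (hw : ∀ ω, 0 ≤ w ω) (Y : Ω → α) (a : α) : 0 ≤ law w Y a := by
  classical
  exact Finset.sum_nonneg fun ω _ => by split_ifs <;> simp [hw]

lemma sum_law_mul [Fintype α] (w : Ω → ℝ) (Y : Ω → α) (g : α → ℝ) :
    ∑ a, law w Y a * g a = ∑ ω, w ω * g (Y ω) := by
  classical
  simp only [law, Finset.sum_mul]
  rw [Finset.sum_comm]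
  refine Finset.sum_congr rfl fun ω _ => ?_
  simp [ite_mul]

lemma sum_law [Fintype α] (w : Ω → ℝ) (Y : Ω → α) : ∑ a, law w Y a = ∑ ω, w ω := by
  simpa using sum_law_mul w Y fun _ => 1

lemma sum_law_prod [Fintype β] (w : Ω → ℝ) (Y : Ω → α) (V : Ω → β) (a : α) :
    ∑ b, law w (fun ω => (Y ω, V ω)) (a, b) = law w Y a := by
  classical
  simp only [law, Prod.mk.injEq]
  rw [Finset.sum_comm]
  refine Finset.sum_congr rfl fun ω _ => ?_
  by_cases h : Y ω = a <;> simp [h]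

lemma le_law {w : Ω → ℝ} (hw : ∀ ω, 0 ≤ w ω) (Y : Ω → α) (ω : Ω) : w ω ≤ law w Y (Y ω) := by
  classical
  refine le_trans (by simp) (Finset.single_le_sum (f := fun ω' => if Y ω' = Y ω then w ω' else 0)
    (fun ω' _ => ?_) (Finset.mem_univ ω))
  split_ifs <;> simp [hw]

lemma law_le_of_ker {w : Ω → ℝ} (hw : ∀ ω, 0 ≤ w ω) {Y : Ω → α} {V : Ω → β} {ω : Ω}
    (h : ∀ ω', Y ω' = Y ω → V ω' = V ω) : law w Y (Y ω) ≤ law w V (V ω) := by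
  classical
  refine Finset.sum_le_sum fun ω' _ => ?_
  by_cases h1 : Y ω' = Y ω
  · simp [h1, h ω' h1]
  · simp only [h1, if_false]
    split_ifs <;> simp [hw]

/-- A function of a random variable has at most its entropy; the functional dependence is expressed
through the kernels of the two variables. -/
lemma entropy_le_of_ker {w : Ω → ℝ} (hw : ∀ ω, 0 ≤ w ω) {Y : Ω → α} {V : Ω → β}
    (h : ∀ ω ω', Y ω' = Y ω → V ω' = V ω) : entropy w V ≤ entropy w Y := by
  refine neg_le_neg (Finset.sum_le_sum fun ω _ => ?_)
  rcases (hw ω).eq_or_lt with h0 | h0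
  · simp [← h0]
  · refine mul_le_mul_of_nonneg_left (Real.log_le_log ?_ (law_le_of_ker hw (h ω))) h0.le
    exact h0.trans_le (le_law hw Y ω)

lemma law_comp_equiv {w : Ω → ℝ} (e : Ω ≃ Ω) (he : ∀ ω, w (e ω) = w ω) (Y : Ω → α) (a : α) :
    law w (fun ω => Y (e ω)) a = law w Y a := by
  classical
  simp only [law]
  rw [← Equiv.sum_comp e fun ω => if Y ω = a then w ω else 0]
  simp [he]

lemma entropy_comp_equiv {w : Ω → ℝ} (e : Ω ≃ Ω) (he : ∀ ω, w (e ω) = w ω) (Y : Ω → α) :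
    entropy w (fun ω => Y (e ω)) = entropy w Y := by
  simp only [entropy, law_comp_equiv e he]
  rw [← Equiv.sum_comp e fun ω => w ω * Real.log (law w Y (Y ω))]
  simp [he]

/-- A form of Pinsker's inequality, `‖law Y - q‖₁ ² ≤ 4 KL(law Y ‖ q)`, for subprobability weights
`q`. It goes through the Hellinger distance: `log u ≤ u - 1` at `u = √(q / p)` bounds the squared
Hellinger distance by the divergence, and the Cauchy-Schwarz inequality bounds the `L¹` distance by
the Hellinger distance. -/
lemma sq_sum_abs_law_sub_le [Fintype α] {w : Ω → ℝ} (hw : ∀ ω, 0 ≤ w ω)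
    (hw1 : ∑ ω, w ω = 1) (Y : Ω → α)
    {q : α → ℝ} (hq : ∀ a, 0 ≤ q a) (hq1 : ∑ a, q a ≤ 1) (hpos : ∀ ω, 0 < w ω → 0 < q (Y ω)) :
    (∑ a, |law w Y a - q a|) ^ 2 ≤
      4 * ∑ ω, w ω * (Real.log (law w Y (Y ω)) - Real.log (q (Y ω))) := by
  classical
  rw [← sum_law_mul w Y fun a => Real.log (law w Y a) - Real.log (q a)]
  have hp := law_nonneg hw Y
  have hp1 : ∑ a, law w Y a = 1 := (sum_law w Y).trans hw1
  have hq' : ∀ a, 0 < law w Y a → 0 < q a := by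
    intro a ha
    obtain ⟨ω, -, hω⟩ := Finset.exists_ne_zero_of_sum_ne_zero ha.ne'
    have h1 : Y ω = a := by by_contra h; simp [h] at hω
    have h2 : w ω ≠ 0 := by simpa [h1] using hω
    exact h1 ▸ hpos ω (lt_of_le_of_ne (hw ω) h2.symm)
  generalize law w Y = p at *
  have key : ∀ a, 2 * p a - 2 * (√(p a) * √(q a)) ≤ p a * (Real.log (p a) - Real.log (q a)) := by
    intro a
    rcases (hp a).eq_or_lt with h0 | h0
    · simp [← h0]
    · have h1 := hq' a h0
      have h2 := Real.log_le_sub_one_of_pos (x := √(q a) / √(p a)) (by positivity)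
      rw [Real.log_div (by positivity) (by positivity), Real.log_sqrt (hq a),
        Real.log_sqrt (hp a)] at h2
      have h3 : p a * (√(q a) / √(p a)) = √(p a) * √(q a) := by
        have h4 : √(p a) ≠ 0 := by positivity
        field_simp
        rw [Real.sq_sqrt h0.le]
      nlinarith [mul_le_mul_of_nonneg_left h2 h0.le]
  have hell : ∑ a, (√(p a) - √(q a)) ^ 2 ≤ ∑ a, p a * (Real.log (p a) - Real.log (q a)) := by
    have h1 : ∑ a, (√(p a) - √(q a)) ^ 2
        = ∑ a, (2 * p a - 2 * (√(p a) * √(q a))) + (∑ a, q a - ∑ a, p a) := by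
      rw [← Finset.sum_sub_distrib, ← Finset.sum_add_distrib]
      refine Finset.sum_congr rfl fun a _ => ?_
      nlinarith [Real.sq_sqrt (hp a), Real.sq_sqrt (hq a)]
    have h2 := Finset.sum_le_sum fun a (_ : a ∈ Finset.univ) => key a
    linarith
  have hplus : ∑ a, (√(p a) + √(q a)) ^ 2 ≤ 4 := by
    have h1 : ∑ a, (√(p a) + √(q a)) ^ 2 ≤ ∑ a, (2 * p a + 2 * q a) := by
      refine Finset.sum_le_sum fun a _ => ?_
      nlinarith [Real.sq_sqrt (hp a), Real.sq_sqrt (hq a), sq_nonneg (√(p a) - √(q a))]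
    rw [Finset.sum_add_distrib, ← Finset.mul_sum, ← Finset.mul_sum] at h1
    linarith
  have hfac : ∀ a, |p a - q a| = |√(p a) - √(q a)| * (√(p a) + √(q a)) := by
    intro a
    rw [← abs_of_nonneg (a := √(p a) + √(q a)) (by positivity), ← abs_mul]
    congr 1
    nlinarith [Real.sq_sqrt (hp a), Real.sq_sqrt (hq a)]
  have hcs := Finset.sum_mul_sq_le_sq_mul_sq Finset.univ (fun a => |√(p a) - √(q a)|)
    fun a => √(p a) + √(q a)
  simp only [sq_abs] at hcs
  simp only [hfac]
  have h0 : 0 ≤ ∑ a, (√(p a) - √(q a)) ^ 2 := by positivity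
  nlinarith

lemma entropy_le_log_card [Fintype α] {w : Ω → ℝ} (hw : ∀ ω, 0 ≤ w ω)
    (hw1 : ∑ ω, w ω = 1) (Y : Ω → α) :
    entropy w Y ≤ Real.log (Fintype.card α) := by
  classical
  have hne : Nonempty Ω := by
    by_contra h
    rw [not_nonempty_iff] at h
    simp at hw1
  have : Nonempty α := hne.map Y
  have hc : (0 : ℝ) < Fintype.card α := by exact_mod_cast Fintype.card_pos
  have h := sq_sum_abs_law_sub_le hw hw1 Y (q := fun _ => (Fintype.card α : ℝ)⁻¹)
    (fun _ => by positivity) (by simp [hc.ne']) (fun _ _ => by positivity)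
  simp only [mul_sub, Finset.sum_sub_distrib, ← Finset.sum_mul, hw1, Real.log_inv] at h
  have h2 := sq_nonneg (∑ a, |law w Y a - (Fintype.card α : ℝ)⁻¹|)
  simp only [entropy]
  linarith

/-- Conditionally on `T`, the variables `V i` are close in `L¹` to being independent if their joint
conditional entropy is close to the sum of the individual ones. -/
lemma sq_sum_abs_law_sub_prod_le {ι : Type*} [Fintype ι] [DecidableEq ι] [Fintype α]
    [Fintype β] {w : Ω → ℝ} (hw : ∀ ω, 0 ≤ w ω) (hw1 : ∑ ω, w ω = 1) (T : Ω → β) (V : ι → Ω → α) :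
    (∑ y : β × (ι → α), |law w (fun ω => (T ω, fun i => V i ω)) y -
        law w T y.1 * ∏ i, (law w (fun ω => (T ω, V i ω)) (y.1, y.2 i) / law w T y.1)|) ^ 2 ≤
      4 * (entropy w T + ∑ i, (entropy w (fun ω => (T ω, V i ω)) - entropy w T)
        - entropy w fun ω => (T ω, fun i => V i ω)) := by
  classical
  have hT := law_nonneg hw T
  have hTV := fun i => law_nonneg hw (fun ω => (T ω, V i ω))
  refine (sq_sum_abs_law_sub_le hw hw1 _ ?_ ?_ ?_).trans_eq ?_
  · intro y
    exact mul_nonneg (hT _) (Finset.prod_nonneg fun i _ => div_nonneg (hTV i _) (hT _))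
  · rw [Fintype.sum_prod_type, ← hw1, ← sum_law w T]
    refine Finset.sum_le_sum fun t _ => ?_
    dsimp only
    rw [← Finset.mul_sum,
      ← Fintype.prod_sum fun i a => law w (fun ω => (T ω, V i ω)) (t, a) / law w T t]
    refine mul_le_of_le_one_right (hT t) (Finset.prod_le_one (fun i _ => ?_) fun i _ => ?_)
    · exact Finset.sum_nonneg fun a _ => div_nonneg (hTV i _) (hT _)
    · rw [← Finset.sum_div, sum_law_prod]
      exact div_self_le_one _
  · intro ω h0
    have h1 := h0.trans_le (le_law hw T ω)
    refine mul_pos h1 (Finset.prod_pos fun i _ => div_pos ?_ h1)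
    exact h0.trans_le (le_law hw (fun ω => (T ω, V i ω)) ω)
  · congr 1
    simp only [entropy]
    have h : ∀ ω, w ω * (Real.log (law w (fun ω => (T ω, fun i => V i ω)) (T ω, fun i => V i ω)) -
        Real.log (law w T (T ω) *
          ∏ i, (law w (fun ω => (T ω, V i ω)) (T ω, V i ω) / law w T (T ω)))) =
        -(w ω * Real.log (law w T (T ω))) +
        ∑ i, (-(w ω * Real.log (law w (fun ω => (T ω, V i ω)) (T ω, V i ω))) -
          -(w ω * Real.log (law w T (T ω)))) -
        -(w ω * Real.log (law w (fun ω => (T ω, fun i => V i ω)) (T ω, fun i => V i ω))) := by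
      intro ω
      rcases (hw ω).eq_or_lt with h0 | h0
      · simp [← h0]
      · have h1 := (h0.trans_le (le_law hw T ω)).ne'
        have h2 := fun i => (h0.trans_le (le_law hw (fun ω => (T ω, V i ω)) ω)).ne'
        rw [Real.log_mul h1 (Finset.prod_ne_zero_iff.2 fun i _ => div_ne_zero (h2 i) h1),
          Real.log_prod fun i _ => div_ne_zero (h2 i) h1]
        simp only [Real.log_div (h2 _) h1, mul_sub, mul_add, Finset.mul_sum,
          Finset.sum_sub_distrib, Finset.sum_neg_distrib]
        ring
    rw [Finset.sum_congr rfl fun ω _ => h ω]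
    simp only [Finset.sum_sub_distrib, Finset.sum_add_distrib, Finset.sum_neg_distrib]
    rw [Finset.sum_comm]
    congr 3
    rw [Finset.sum_comm]

end Entropy
/-! ### Product weights -/

section Products

variable {X : Type*} [Fintype X]

lemma sum_prod_weight {ι : Type*} [Fintype ι] [DecidableEq ι] {d : X → ℝ} (hd : ∑ x, d x = 1) :
    ∑ S : ι → X, ∏ i, d (S i) = 1 := by
  rw [← Fintype.prod_sum fun (_ : ι) x => d x]
  simp [hd]

/-- Reading an i.i.d. sample along an injection gives an i.i.d. sample. -/
lemma sum_prod_weight_comp {ι κ : Type*} [Fintype ι] [DecidableEq ι] [Fintype κ] [DecidableEq κ]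
    {d : X → ℝ} (hd : ∑ x, d x = 1) {σ : κ → ι} (hσ : Function.Injective σ) (g : (κ → X) → ℝ) :
    ∑ S : ι → X, (∏ i, d (S i)) * g (S ∘ σ) = ∑ T : κ → X, (∏ j, d (T j)) * g T := by
  classical
  have h1 : ∀ T : κ → X,
      ∑ S : ι → X, (∏ i, d (S i)) * (if S ∘ σ = T then 1 else 0) = ∏ j, d (T j) := by
    intro T
    have h2 : ∀ S : ι → X, (∏ i, d (S i)) * (if S ∘ σ = T then 1 else 0)
        = ∏ i, d (S i) * (if ∀ j, σ j = i → S i = T j then 1 else 0) := by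
      intro S
      rw [Finset.prod_mul_distrib, Finset.prod_boole]
      congr 2
      simp only [funext_iff, Function.comp_apply, Finset.mem_univ, true_implies, eq_iff_iff]
      exact ⟨by rintro h i j rfl; exact h j, fun h j => h _ j rfl⟩
    rw [Finset.sum_congr rfl fun S _ => h2 S,
      ← Fintype.prod_sum fun i x => d x * (if ∀ j, σ j = i → x = T j then 1 else 0)]
    symm
    refine Fintype.prod_of_injective σ hσ _ _ (fun i hi => ?_) fun j => ?_
    · have h3 : ∀ j, σ j ≠ i := fun j hj => hi ⟨j, hj⟩
      simp [h3, hd]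
    · simp [hσ.eq_iff]
  have h4 : ∀ S : ι → X, g (S ∘ σ) = ∑ T, (if S ∘ σ = T then 1 else 0) * g T := by
    intro S
    simp
  simp only [h4, Finset.mul_sum]
  rw [Finset.sum_comm]
  refine Finset.sum_congr rfl fun T _ => ?_
  rw [← h1 T, Finset.sum_mul]
  exact Finset.sum_congr rfl fun S _ => by ring

lemma sum_fin_succ_pi {n : ℕ} (g : (Fin (n + 1) → X) → ℝ) :
    ∑ S, g S = ∑ x, ∑ S : Fin n → X, g (Fin.cons x S) := by
  rw [← Fintype.sum_prod_type' fun x S => g (Fin.cons x S)]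
  exact (Equiv.sum_comp (Fin.consEquiv fun _ : Fin (n + 1) => X) g).symm

lemma sum_abs_prod_sub_prod_le {d e : X → ℝ} (hd : ∀ x, 0 ≤ d x) (hd1 : ∑ x, d x = 1)
    (he : ∀ x, 0 ≤ e x) (he1 : ∑ x, e x = 1) (n : ℕ) :
    ∑ S : Fin n → X, |∏ i, d (S i) - ∏ i, e (S i)| ≤ n * ∑ x, |d x - e x| := by
  induction n with
  | zero => simp
  | succ n ih =>
    rw [sum_fin_succ_pi]
    simp only [Fin.prod_univ_succ, Fin.cons_zero, Fin.cons_succ]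
    have h1 : ∀ x (S : Fin n → X), |d x * ∏ i, d (S i) - e x * ∏ i, e (S i)| ≤
        d x * |∏ i, d (S i) - ∏ i, e (S i)| + |d x - e x| * ∏ i, e (S i) := by
      intro x S
      have h2 : 0 ≤ ∏ i, e (S i) := Finset.prod_nonneg fun i _ => he _
      calc _ = |d x * (∏ i, d (S i) - ∏ i, e (S i)) + (d x - e x) * ∏ i, e (S i)| := by
            congr 1; ring
        _ ≤ _ := by
            refine (abs_add_le _ _).trans_eq ?_
            rw [abs_mul, abs_mul, abs_of_nonneg (hd x), abs_of_nonneg h2]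
    refine (Finset.sum_le_sum fun x _ => Finset.sum_le_sum fun S _ => h1 x S).trans ?_
    simp only [Finset.sum_add_distrib, ← Finset.mul_sum, ← Finset.sum_mul, hd1,
      sum_prod_weight he1]
    push_cast
    linarith

lemma sum_prod_mul_sq_sum {p g : X → ℝ} (hp1 : ∑ x, p x = 1) (hg : ∑ x, p x * g x = 0) (m : ℕ) :
    ∑ S : Fin m → X, (∏ i, p (S i)) * (∑ i, g (S i)) ^ 2 = m * ∑ x, p x * g x ^ 2 := by
  induction m with
  | zero => simp
  | succ m ih =>
    rw [sum_fin_succ_pi]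
    simp only [Fin.prod_univ_succ, Fin.sum_univ_succ, Fin.cons_zero, Fin.cons_succ]
    have h : ∀ x (S : Fin m → X), p x * (∏ i, p (S i)) * (g x + ∑ i, g (S i)) ^ 2 =
        (p x * g x ^ 2) * (∏ i, p (S i)) +
        (p x * g x) * (2 * ((∏ i, p (S i)) * ∑ i, g (S i))) +
        p x * ((∏ i, p (S i)) * (∑ i, g (S i)) ^ 2) := by
      intro x S; ring
    simp only [h, Finset.sum_add_distrib, ← Finset.mul_sum, ← Finset.sum_mul, hg, hp1, ih,
      sum_prod_weight hp1]
    push_cast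
    ring

/-- Chebyshev's inequality for the average of `m` independent costs with values in `[0, K]` and
mean at most `1 - γ`. -/
lemma chebyshev_sum_cost {p c : X → ℝ} (hp : ∀ x, 0 ≤ p x) (hp1 : ∑ x, p x = 1)
    {K γ : ℝ} (hγ : 0 < γ) (hc : ∀ x, 0 ≤ c x) (hcK : ∀ x, c x ≤ K)
    (hmean : ∑ x, p x * c x ≤ 1 - γ) (hK : 0 ≤ K) (m : ℕ) :
    (γ * m) ^ 2 * ∑ S : Fin m → X, (∏ i, p (S i)) * (if (m : ℝ) < ∑ i, c (S i) then 1 else 0) ≤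
      m * K := by
  set μ := ∑ x, p x * c x with hμ
  have hg0 : ∑ x, p x * (c x - μ) = 0 := by
    simp only [mul_sub, Finset.sum_sub_distrib, ← Finset.sum_mul, hp1, ← hμ]; ring
  have hvar : ∑ x, p x * (c x - μ) ^ 2 ≤ K := by
    have h1 : ∑ x, p x * (c x - μ) ^ 2 = ∑ x, (p x * c x) * c x - μ ^ 2 := by
      have h2 : ∀ x, p x * (c x - μ) ^ 2 = p x * c x * c x - 2 * μ * (p x * c x) + p x * μ ^ 2 := by
        intro x; ring
      simp only [h2, Finset.sum_add_distrib, Finset.sum_sub_distrib, ← Finset.mul_sum,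
        ← Finset.sum_mul, hp1, ← hμ]
      ring
    have h3 : ∑ x, (p x * c x) * c x ≤ ∑ x, (p x * c x) * K :=
      Finset.sum_le_sum fun x _ => mul_le_mul_of_nonneg_left (hcK x) (mul_nonneg (hp x) (hc x))
    rw [← Finset.sum_mul] at h3
    nlinarith [sq_nonneg μ]
  have hmain := sum_prod_mul_sq_sum hp1 hg0 m
  have hbound : (γ * m) ^ 2 *
      ∑ S : Fin m → X, (∏ i, p (S i)) * (if (m : ℝ) < ∑ i, c (S i) then 1 else 0) ≤
      ∑ S : Fin m → X, (∏ i, p (S i)) * (∑ i, (c (S i) - μ)) ^ 2 := by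
    rw [Finset.mul_sum]
    refine Finset.sum_le_sum fun S _ => ?_
    have h0 : 0 ≤ ∏ i, p (S i) := Finset.prod_nonneg fun i _ => hp _
    rw [mul_left_comm]
    refine mul_le_mul_of_nonneg_left ?_ h0
    split_ifs with h
    · have h1 : ∑ i, (c (S i) - μ) = ∑ i, c (S i) - m * μ := by simp
      have h2 : γ * m ≤ ∑ i, (c (S i) - μ) := by
        rw [h1]; nlinarith [Nat.cast_nonneg (α := ℝ) m]
      rw [mul_one]
      exact pow_le_pow_left₀ (by positivity) h2 2
    · simpa using sq_nonneg _
  refine hbound.trans ?_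
  rw [hmain]
  exact mul_le_mul_of_nonneg_left hvar (Nat.cast_nonneg m)

end Products
/-! ### Distributions as real weights -/

section Bridge

variable {X : Type*}

lemma sum_toReal_pmf {α : Type*} [Fintype α] (D : PMF α) : ∑ x, (D x).toReal = 1 := by
  rw [← ENNReal.toReal_sum fun x _ => D.apply_ne_top x, ← tsum_fintype (L := .unconditional α),
    D.tsum_coe, ENNReal.toReal_one]

lemma iid_toReal [Fintype X] (D : PMF X) {n : ℕ} (S : Fin n → X) :
    (iid D n S).toReal = ∏ i, (D (S i)).toReal := by
  simp [iid, ENNReal.toReal_prod]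

/-- The distribution with the given real probabilities. -/
noncomputable def ofWeights {α : Type*} [Fintype α] (w : α → ℝ) (h0 : ∀ a, 0 ≤ w a)
    (h1 : ∑ a, w a = 1) : PMF α :=
  PMF.ofFintype (fun a => ENNReal.ofReal (w a)) (by
    rw [← ENNReal.ofReal_sum_of_nonneg fun a _ => h0 a, h1, ENNReal.ofReal_one])

lemma ofWeights_apply {α : Type*} [Fintype α] (w : α → ℝ) (h0 : ∀ a, 0 ≤ w a)
    (h1 : ∑ a, w a = 1) (a : α) : ofWeights w h0 h1 a = ENNReal.ofReal (w a) := rfl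

lemma Algorithm.accept_nonneg {n : ℕ} (f : Algorithm X n Bool) (S : Fin n → X) :
    0 ≤ f.accept S := ENNReal.toReal_nonneg

lemma Algorithm.accept_le_one {n : ℕ} (f : Algorithm X n Bool) (S : Fin n → X) :
    f.accept S ≤ 1 := by
  exact ENNReal.toReal_mono ENNReal.one_ne_top ((f S).coe_le_one true)

lemma subsample_eq_map {n m : ℕ} (h : n ≤ m) (S : Fin m → X) [Nonempty (Fin n ↪ Fin m)] :
    subsample h S = (PMF.uniformOfFintype (Fin n ↪ Fin m)).map fun σ : Fin n ↪ Fin m => S ∘ σ := by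
  change PMF.map (fun σ => S ∘ σ)
    ((PMF.uniformOfFintype (Fin n ↪ Fin m)).map fun σ : Fin n ↪ Fin m => (σ : Fin n → Fin m)) = _
  rw [PMF.map_comp]
  rfl

lemma Algorithm.accept_test_afterSubsample {Y : Type*} {n m : ℕ} (A : Algorithm X n Y) (h : n ≤ m)
    (T : Y → Bool) (S : Fin m → X) :
    ((A.afterSubsample h).test T).accept S =
      (Fintype.card (Fin n ↪ Fin m) : ℝ)⁻¹ *
        ∑ σ : Fin n ↪ Fin m, (A.test T).accept (S ∘ σ) := by
  have : Nonempty (Fin n ↪ Fin m) := ⟨Fin.castLEEmb h⟩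
  simp only [Algorithm.accept, Algorithm.test, Algorithm.afterSubsample, subsample_eq_map,
    PMF.map_bind, PMF.bind_map, PMF.bind_apply, tsum_fintype, PMF.uniformOfFintype_apply,
    Function.comp_apply, ← Finset.mul_sum]
  rw [ENNReal.toReal_mul, ENNReal.toReal_sum fun σ _ => PMF.apply_ne_top _ _]
  simp

variable [Fintype X]

lemma expect_iid_le_one (D : PMF X) {n : ℕ} (f : Algorithm X n Bool) :
    expect (iid D n) f.accept ≤ 1 := by
  rw [expect, ← sum_toReal_pmf (iid D n)]
  exact Finset.sum_le_sum fun S _ =>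
    mul_le_of_le_one_right ENNReal.toReal_nonneg (f.accept_le_one S)

lemma expect_le_obliviousMax {ρ : CostFunction X} {D D' : PMF X} (h : D' ∈ distCorruptions ρ D)
    {n : ℕ} (f : Algorithm X n Bool) :
    expect (iid D' n) f.accept ≤ obliviousMax ρ f D :=
  le_ciSup (f := fun D' : distCorruptions ρ D => expect (iid (D' : PMF X) n) f.accept)
    ⟨1, by rintro _ ⟨D', rfl⟩; exact expect_iid_le_one _ f⟩ ⟨D', h⟩

lemma mem_distCorruptions_self (ρ : CostFunction X) (D : PMF X) : D ∈ distCorruptions ρ D := by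
  classical
  refine ⟨D.map fun x => (x, x), ?_, ?_, ?_⟩
  · rw [PMF.map_comp]; exact D.map_id
  · rw [PMF.map_comp]; exact D.map_id
  · refine le_trans (le_of_eq (Finset.sum_eq_zero fun p _ => ?_)) zero_le_one
    by_cases h : p.1 = p.2
    · rw [h, ρ.cost_self, mul_zero]
    · have : (D.map fun x => (x, x)) p = 0 := by
        rw [PMF.apply_eq_zero_iff]
        simp only [PMF.support_map, Set.mem_image, not_exists, not_and]
        rintro x - rfl
        exact h rfl
      rw [this, zero_mul]

/-- The product expectation of a `[0, 1]`-valued function is `n`-Lipschitz in the `L¹` distance of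
the base weights. -/
lemma sum_prod_mul_accept_le {d e : X → ℝ} (hd : ∀ x, 0 ≤ d x) (hd1 : ∑ x, d x = 1)
    (he : ∀ x, 0 ≤ e x) (he1 : ∑ x, e x = 1) {n : ℕ} (f : Algorithm X n Bool) :
    ∑ S, (∏ i, d (S i)) * f.accept S ≤
      ∑ S, (∏ i, e (S i)) * f.accept S + n * ∑ x, |d x - e x| := by
  refine le_trans ?_ (add_le_add_right (sum_abs_prod_sub_prod_le hd hd1 he he1 n) _)
  rw [← Finset.sum_add_distrib]
  refine Finset.sum_le_sum fun S _ => ?_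
  have h1 := le_abs_self (∏ i, d (S i) - ∏ i, e (S i))
  have h2 := abs_nonneg (∏ i, d (S i) - ∏ i, e (S i))
  nlinarith [f.accept_nonneg S, f.accept_le_one S]

/-! ### Completing a partial coupling by leaving points unchanged -/

open scoped Classical in
/-- Given weights `κ` whose first marginal is at most `d`, the missing mass of `d` is put on the
diagonal, where it costs nothing. The result is a coupling with first marginal `d`. -/
noncomputable def completeDiag (d : X → ℝ) (κ : X → X → ℝ) (x y : X) : ℝ :=
  κ x y + if x = y then d x - ∑ z, κ x z else 0

variable {d : X → ℝ} {κ : X → X → ℝ}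

lemma completeDiag_nonneg (hκ : ∀ x y, 0 ≤ κ x y) (hκd : ∀ x, ∑ y, κ x y ≤ d x) (x y : X) :
    0 ≤ completeDiag d κ x y := by
  classical
  refine add_nonneg (hκ x y) ?_
  split_ifs
  · exact sub_nonneg.2 (hκd x)
  · rfl

lemma sum_completeDiag_right (d : X → ℝ) (κ : X → X → ℝ) (x : X) :
    ∑ y, completeDiag d κ x y = d x := by
  classical
  simp [completeDiag, Finset.sum_add_distrib]

lemma sum_completeDiag_left (d : X → ℝ) (κ : X → X → ℝ) (y : X) :
    ∑ x, completeDiag d κ x y = ∑ x, κ x y + (d y - ∑ z, κ y z) := by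
  classical
  simp [completeDiag, Finset.sum_add_distrib]

lemma completeDiag_of_ne (d : X → ℝ) (κ : X → X → ℝ) {x y : X} (h : x ≠ y) :
    completeDiag d κ x y = κ x y := by
  simp [completeDiag, h]

lemma sum_sum_completeDiag (d : X → ℝ) (κ : X → X → ℝ) :
    ∑ x, ∑ y, completeDiag d κ x y = ∑ x, d x := by
  simp only [sum_completeDiag_right]

/-- If `κ` is obtained from the coupling `π` by removing mass, then completing `κ` changes the
second marginal of `π` by at most twice the removed mass. -/
lemma sum_abs_completeDiag_sub_le {π : X → X → ℝ} (hκd : ∀ x, ∑ y, κ x y ≤ d x)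
    (hκπ : ∀ x y, κ x y ≤ π x y) (hd1 : ∑ x, d x = 1) (hπ1 : ∑ x, ∑ y, π x y = 1) :
    ∑ y, |∑ x, π x y - ∑ x, completeDiag d κ x y| ≤ 2 * (1 - ∑ x, ∑ y, κ x y) := by
  have h1 : ∀ y, |∑ x, π x y - ∑ x, completeDiag d κ x y| ≤
      ∑ x, (π x y - κ x y) + (d y - ∑ z, κ y z) := by
    intro y
    have h2 : 0 ≤ ∑ x, (π x y - κ x y) := Finset.sum_nonneg fun x _ => sub_nonneg.2 (hκπ x y)
    have h3 := hκd y
    rw [Finset.sum_sub_distrib] at h2 ⊢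
    rw [sum_completeDiag_left, abs_le]
    constructor <;> linarith
  refine (Finset.sum_le_sum fun y _ => h1 y).trans_eq ?_
  simp only [Finset.sum_add_distrib, Finset.sum_sub_distrib, hd1]
  rw [Finset.sum_comm, hπ1, Finset.sum_comm (f := fun y x => κ x y)]
  ring

lemma sum_completeDiag_mul_cost (ρ : CostFunction X) (d : X → ℝ) (κ : X → X → ℝ) :
    ∑ x, ∑ y, ENNReal.ofReal (completeDiag d κ x y) * ρ.cost x y =
      ∑ x, ∑ y, ENNReal.ofReal (κ x y) * ρ.cost x y := by
  refine Finset.sum_congr rfl fun x _ => Finset.sum_congr rfl fun y _ => ?_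
  by_cases h : x = y
  · rw [h, ρ.cost_self, mul_zero, mul_zero]
  · rw [completeDiag_of_ne d κ h]

/-- A real-weighted coupling of expected cost at most `1` witnesses a legal corruption. -/
lemma sum_prod_mul_accept_le_obliviousMax {ρ : CostFunction X} {D : PMF X} {c : X → X → ℝ}
    (hc : ∀ x y, 0 ≤ c x y) (hcD : ∀ x, ∑ y, c x y = (D x).toReal)
    (hcost : ∑ x, ∑ y, ENNReal.ofReal (c x y) * ρ.cost x y ≤ 1) {n : ℕ}
    (f : Algorithm X n Bool) :
    ∑ S, (∏ i, ∑ x, c x (S i)) * f.accept S ≤ obliviousMax ρ f D := by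
  classical
  have hc1 : ∑ p : X × X, c p.1 p.2 = 1 := by
    rw [Fintype.sum_prod_type]
    simp only [hcD, sum_toReal_pmf]
  set π : PMF (X × X) := ofWeights (fun p => c p.1 p.2) (fun p => hc _ _) hc1 with hπ
  have hfst : π.map Prod.fst = D := by
    ext x
    rw [PMF.map_apply, tsum_fintype, Fintype.sum_prod_type]
    simp only [hπ, ofWeights_apply]
    rw [Finset.sum_eq_single x (by intro b _ hb; simp [hb.symm]) (by simp)]
    simp only [if_true]
    rw [← ENNReal.ofReal_sum_of_nonneg fun y _ => hc x y, hcD,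
      ENNReal.ofReal_toReal (D.apply_ne_top x)]
  have hsnd : ∀ y, (π.map Prod.snd y).toReal = ∑ x, c x y := by
    intro y
    rw [PMF.map_apply, tsum_fintype, Fintype.sum_prod_type]
    simp only [hπ, ofWeights_apply, Finset.sum_ite_eq, Finset.mem_univ, if_true]
    rw [← ENNReal.ofReal_sum_of_nonneg fun x _ => hc x y,
      ENNReal.toReal_ofReal (Finset.sum_nonneg fun x _ => hc x y)]
  have hmem : π.map Prod.snd ∈ distCorruptions ρ D := by
    refine ⟨π, hfst, rfl, ?_⟩
    rw [Fintype.sum_prod_type]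
    exact hcost
  refine le_trans (le_of_eq ?_) (expect_le_obliviousMax hmem f)
  simp only [expect, iid_toReal, hsnd]

/-- If `κ` is a partial coupling starting from `D` of cost at most `1` and a part of the
coupling `π`, then the oblivious adversary does almost as well as the second marginal of `π`. -/
lemma sum_prod_mul_accept_le_obliviousMax_add {ρ : CostFunction X} {D : PMF X}
    {π : X → X → ℝ} (hκ : ∀ x y, 0 ≤ κ x y) (hκD : ∀ x, ∑ y, κ x y ≤ (D x).toReal)
    (hκπ : ∀ x y, κ x y ≤ π x y) (hπ1 : ∑ x, ∑ y, π x y = 1)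
    (hcost : ∑ x, ∑ y, ENNReal.ofReal (κ x y) * ρ.cost x y ≤ 1) {n : ℕ}
    (f : Algorithm X n Bool) :
    ∑ S, (∏ i, ∑ x, π x (S i)) * f.accept S ≤
      obliviousMax ρ f D + n * (2 * (1 - ∑ x, ∑ y, κ x y)) := by
  have hD1 := sum_toReal_pmf D
  have hc := completeDiag_nonneg hκ hκD
  have hc1 : ∑ y, ∑ x, completeDiag (fun x => (D x).toReal) κ x y = 1 := by
    rw [Finset.sum_comm, sum_sum_completeDiag, hD1]
  refine (sum_prod_mul_accept_le (fun y => Finset.sum_nonneg fun x _ => (hκ x y).trans (hκπ x y))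
    (by rw [Finset.sum_comm, hπ1]) (fun y => Finset.sum_nonneg fun x _ => hc x y) hc1 f).trans ?_
  refine add_le_add (sum_prod_mul_accept_le_obliviousMax hc (sum_completeDiag_right _ _)
    ((sum_completeDiag_mul_cost ρ _ κ).trans_le hcost) f) ?_
  exact mul_le_mul_of_nonneg_left (sum_abs_completeDiag_sub_le hκD hκπ hD1 hπ1)
    (Nat.cast_nonneg n)

end Bridge
/-! ### The adaptive adversary simulates the oblivious one -/

section ObliviousLeAdaptive

lemma sum_prod_weight_map {α X : Type*} [Fintype α] [Fintype X] [DecidableEq X] {q : α → ℝ}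
    {d : X → ℝ} {φ : α → X} (hφ : ∀ x, ∑ a, (if φ a = x then q a else 0) = d x) {m : ℕ}
    (h : (Fin m → X) → ℝ) :
    ∑ W : Fin m → α, (∏ i, q (W i)) * h (fun i => φ (W i)) = ∑ S, (∏ i, d (S i)) * h S := by
  have h1 : ∀ W : Fin m → α, h (fun i => φ (W i)) =
      ∑ S, (∏ i, if φ (W i) = S i then 1 else 0) * h S := by
    intro W
    have h2 : ∀ S : Fin m → X, (∀ i, φ (W i) = S i) ↔ (fun i => φ (W i)) = S :=
      fun S => funext_iff.symm
    simp [Finset.prod_boole, h2]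
  simp only [h1, Finset.mul_sum]
  rw [Finset.sum_comm]
  refine Finset.sum_congr rfl fun S _ => ?_
  simp only [← hφ]
  rw [Fintype.prod_sum, Finset.sum_mul]
  refine Finset.sum_congr rfl fun W _ => ?_
  rw [← mul_assoc, ← Finset.prod_mul_distrib]
  simp only [mul_ite, mul_one, mul_zero]

variable {X : Type*}

lemma accept_le_ciSup {ρ : CostFunction X} {m : ℕ} (F : Algorithm X m Bool) {S S' : Fin m → X}
    (h : S' ∈ sampleCorruptions ρ S) :
    F.accept S' ≤ ⨆ S' : sampleCorruptions ρ S, F.accept S' :=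
  le_ciSup (f := fun S' : sampleCorruptions ρ S => F.accept S')
    ⟨1, by rintro _ ⟨S', rfl⟩; exact F.accept_le_one _⟩ ⟨S', h⟩

lemma mem_sampleCorruptions_self (ρ : CostFunction X) {m : ℕ} (S : Fin m → X) :
    S ∈ sampleCorruptions ρ S := by
  simp [sampleCorruptions, ρ.cost_self]

variable [Fintype X]

/-- Subsampling an i.i.d. sample gives an i.i.d. sample. -/
lemma sum_prod_mul_accept_subsample {n m : ℕ} (hnm : n ≤ m) {f : Algorithm X n Bool}
    {F : Algorithm X m Bool} (hF : ∀ S, F.accept S = (Fintype.card (Fin n ↪ Fin m) : ℝ)⁻¹ *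
      ∑ σ : Fin n ↪ Fin m, f.accept (S ∘ σ)) {d : X → ℝ} (hd1 : ∑ x, d x = 1) :
    ∑ S, (∏ i, d (S i)) * F.accept S = ∑ S, (∏ i, d (S i)) * f.accept S := by
  have : Nonempty (Fin n ↪ Fin m) := ⟨Fin.castLEEmb hnm⟩
  have hc : (Fintype.card (Fin n ↪ Fin m) : ℝ) ≠ 0 := by
    exact_mod_cast Fintype.card_ne_zero
  have h1 : ∀ S : Fin m → X, (∏ i, d (S i)) * F.accept S =
      (Fintype.card (Fin n ↪ Fin m) : ℝ)⁻¹ *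
        ∑ σ : Fin n ↪ Fin m, (∏ i, d (S i)) * f.accept (S ∘ σ) := by
    intro S
    rw [hF, mul_left_comm, Finset.mul_sum]
  rw [Finset.sum_congr rfl fun S _ => h1 S, ← Finset.mul_sum, Finset.sum_comm,
    Finset.sum_congr rfl fun (σ : Fin n ↪ Fin m) _ =>
      sum_prod_weight_comp hd1 σ.injective f.accept]
  rw [Finset.sum_const, nsmul_eq_mul, Finset.card_univ, inv_mul_cancel_left₀ hc]

/-- The adaptive adversary draws the corruption of each point independently from a coupling of
bounded cost whose mean cost is strictly below `1`. By Chebyshev's inequality its budget suffices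
with high probability, and the corrupted sample is i.i.d. -/
lemma sum_prod_mul_accept_le_adaptiveMax {ρ : CostFunction X} {D : PMF X} {q : X → X → ℝ}
    (hq : ∀ x y, 0 ≤ q x y) (hqD : ∀ x, ∑ y, q x y = (D x).toReal) {c : X → X → ℝ}
    (hc : ∀ x y, 0 ≤ c x y) {K γ : ℝ} (hK : 0 ≤ K) (hγ : 0 < γ) (hcK : ∀ x y, c x y ≤ K)
    (hqc : ∀ x y, 0 < q x y → ρ.cost x y = ENNReal.ofReal (c x y))
    (hmean : ∑ x, ∑ y, q x y * c x y ≤ 1 - γ) {m : ℕ} (hm : 0 < m) (F : Algorithm X m Bool) :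
    ∑ S, (∏ i, ∑ x, q x (S i)) * F.accept S ≤ adaptiveMax ρ F D + K / (γ ^ 2 * m) := by
  classical
  set Q : X × X → ℝ := fun p => q p.1 p.2 with hQ
  have hQ0 : ∀ p, 0 ≤ Q p := fun p => hq _ _
  have hQ1 : ∑ p, Q p = 1 := by
    rw [Fintype.sum_prod_type]; simp only [hQ, hqD, sum_toReal_pmf]
  have hm' : (0 : ℝ) < m := by exact_mod_cast hm
  have hfst : ∀ x, ∑ p : X × X, (if p.1 = x then Q p else 0) = (D x).toReal := by
    intro x
    rw [Fintype.sum_prod_type, Finset.sum_eq_single x (by intro b _ hb; simp [hb]) (by simp)]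
    simp [hQ, hqD]
  have hsnd : ∀ y, ∑ p : X × X, (if p.2 = y then Q p else 0) = ∑ x, q x y := by
    intro y
    rw [Fintype.sum_prod_type]
    simp [hQ]
  have hcheb := chebyshev_sum_cost hQ0 hQ1 (c := fun p => c p.1 p.2) hγ (fun p => hc _ _)
    (fun p => hcK _ _) (by rw [Fintype.sum_prod_type]; exact hmean) hK m
  have hcheb' : ∑ W : Fin m → X × X,
      (∏ i, Q (W i)) * (if (m : ℝ) < ∑ i, c (W i).1 (W i).2 then 1 else 0) ≤
        K / (γ ^ 2 * m) := by
    rw [le_div_iff₀ (by positivity)]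
    refine le_of_mul_le_mul_left ?_ hm'
    refine le_trans (le_of_eq ?_) hcheb
    ring
  rw [← sum_prod_weight_map hsnd]
  have hadapt : adaptiveMax ρ F D = ∑ W : Fin m → X × X, (∏ i, Q (W i)) *
      (fun S : Fin m → X => ⨆ S' : sampleCorruptions ρ S, F.accept S') (fun i => (W i).1) := by
    have h := sum_prod_weight_map hfst
      fun S : Fin m → X => ⨆ S' : sampleCorruptions ρ S, F.accept S'
    simp only [adaptiveMax, expect, iid_toReal]
    exact h.symm
  rw [hadapt]
  refine le_trans ?_ (add_le_add_right hcheb' _)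
  rw [← Finset.sum_add_distrib]
  refine Finset.sum_le_sum fun W _ => ?_
  rw [← mul_add]
  have hW0 : 0 ≤ ∏ i, Q (W i) := Finset.prod_nonneg fun i _ => hQ0 _
  rcases hW0.eq_or_lt with h0 | h0
  · simp [← h0]
  refine mul_le_mul_of_nonneg_left ?_ hW0
  have hsup := (F.accept_nonneg _).trans
    (accept_le_ciSup F (mem_sampleCorruptions_self ρ fun i => (W i).1))
  split_ifs with hlt
  · exact (F.accept_le_one _).trans (by linarith)
  · rw [add_zero]
    refine accept_le_ciSup F ?_
    have hpos : ∀ i, 0 < q (W i).1 (W i).2 := fun i =>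
      lt_of_le_of_ne (hQ0 _) fun h => h0.ne' (Finset.prod_eq_zero (Finset.mem_univ i) h.symm)
    simp only [sampleCorruptions, Set.mem_ofPred_eq, hqc _ _ (hpos _)]
    rw [← ENNReal.ofReal_sum_of_nonneg fun i _ => hc _ _, mul_comm, ← div_eq_mul_inv]
    refine ENNReal.div_le_of_le_mul ?_
    rw [one_mul, ← ENNReal.ofReal_natCast]
    exact ENNReal.ofReal_le_ofReal (not_lt.1 hlt)

/-- To make the cost bounded by `1 / γ` with mean at most `1 - γ`, the coupling of the oblivious
adversary is discarded where it is more expensive than `1 / γ`, and with probability `γ` elsewhere.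
By Markov's inequality this moves the corrupted distribution by `O(γ)`. -/
lemma obliviousMax_le_adaptiveMax_add {n m : ℕ} (hnm : n ≤ m) {f : Algorithm X n Bool}
    {F : Algorithm X m Bool} (hF : ∀ S, F.accept S = (Fintype.card (Fin n ↪ Fin m) : ℝ)⁻¹ *
      ∑ σ : Fin n ↪ Fin m, f.accept (S ∘ σ)) (ρ : CostFunction X) (D : PMF X) {γ : ℝ}
    (hγ : 0 < γ) (hγ1 : γ ≤ 1) (hm : 0 < m) :
    obliviousMax ρ f D ≤ adaptiveMax ρ F D + (n * (4 * γ) + 1 / (γ ^ 3 * m)) := by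
  classical
  have : Nonempty (distCorruptions ρ D) := ⟨⟨D, mem_distCorruptions_self ρ D⟩⟩
  refine ciSup_le ?_
  rintro ⟨_, π, hfst, rfl, hcost⟩
  set p : X → X → ℝ := fun x y => (π (x, y)).toReal with hp
  have hp0 : ∀ x y, 0 ≤ p x y := fun x y => ENNReal.toReal_nonneg
  have hp1 : ∑ x, ∑ y, p x y = 1 := by
    rw [← Fintype.sum_prod_type' p]; exact sum_toReal_pmf π
  have hpD : ∀ x, ∑ y, p x y = (D x).toReal := by
    intro x
    have h : π.map Prod.fst x = ∑ y, π (x, y) := by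
      rw [PMF.map_apply, tsum_fintype, Fintype.sum_prod_type,
        Finset.sum_eq_single x (by intro b _ hb; simp [hb.symm]) (by simp)]
      simp
    rw [← hfst, h, ENNReal.toReal_sum fun y _ => π.apply_ne_top _]
  have hpsnd : ∀ y, (π.map Prod.snd y).toReal = ∑ x, p x y := by
    intro y
    rw [PMF.map_apply, tsum_fintype, Fintype.sum_prod_type]
    simp only [Finset.sum_ite_eq, Finset.mem_univ, if_true]
    rw [ENNReal.toReal_sum fun y _ => π.apply_ne_top _]
  rw [Fintype.sum_prod_type] at hcost
  -- Markov's inequality: the expensive part of the coupling has mass at most `γ`.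
  have hmarkov : ∑ x, ∑ y, p x y * (if ρ.cost x y ≤ ENNReal.ofReal (1 / γ) then 0 else 1) ≤ γ := by
    have h1 : ENNReal.ofReal (∑ x, ∑ y,
        1 / γ * (p x y * (if ρ.cost x y ≤ ENNReal.ofReal (1 / γ) then 0 else 1))) ≤ 1 := by
      refine le_trans ?_ hcost
      have h0 : ∀ x y, 0 ≤
          1 / γ * (p x y * (if ρ.cost x y ≤ ENNReal.ofReal (1 / γ) then 0 else 1)) := by
        intro x y
        have := hp0 x y
        split_ifs <;> positivity
      rw [ENNReal.ofReal_sum_of_nonneg fun x _ => Finset.sum_nonneg fun y _ => h0 x y]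
      refine Finset.sum_le_sum fun x _ => ?_
      rw [ENNReal.ofReal_sum_of_nonneg fun y _ => h0 x y]
      refine Finset.sum_le_sum fun y _ => ?_
      split_ifs with h
      · simp
      · rw [mul_one, mul_comm, ENNReal.ofReal_mul (hp0 x y), hp,
          ENNReal.ofReal_toReal (π.apply_ne_top _)]
        gcongr
        exact (not_le.1 h).le
    rw [ENNReal.ofReal_le_one] at h1
    simp only [← Finset.mul_sum] at h1
    rw [div_mul_eq_mul_div, one_mul, div_le_one hγ] at h1
    exact h1
  set c : X → X → ℝ :=
    fun x y => if ρ.cost x y ≤ ENNReal.ofReal (1 / γ) then (ρ.cost x y).toReal else 0 with hcdef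
  have hc0 : ∀ x y, 0 ≤ c x y := by
    intro x y; simp only [hcdef]; split_ifs <;> simp
  have hcK : ∀ x y, c x y ≤ 1 / γ := by
    intro x y; simp only [hcdef]
    split_ifs with h
    · exact ENNReal.toReal_le_of_le_ofReal (by positivity) h
    · positivity
  have hpc : ∑ x, ∑ y, p x y * c x y ≤ 1 := by
    have h1 := ENNReal.toReal_mono ENNReal.one_ne_top hcost
    have hfin : ∀ x, ∑ y, π (x, y) * ρ.cost x y ≠ ∞ := fun x =>
      ((Finset.single_le_sum (f := fun x => ∑ y, π (x, y) * ρ.cost x y) (fun _ _ => zero_le)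
        (Finset.mem_univ x)).trans_lt (hcost.trans_lt ENNReal.one_lt_top)).ne
    rw [ENNReal.toReal_sum fun x _ => hfin x, ENNReal.toReal_one] at h1
    refine le_trans (Finset.sum_le_sum fun x _ => ?_) h1
    rw [ENNReal.toReal_sum fun y _ => (ENNReal.sum_ne_top.1 (hfin x)) y (Finset.mem_univ y)]
    refine Finset.sum_le_sum fun y _ => ?_
    rw [ENNReal.toReal_mul]
    refine mul_le_mul_of_nonneg_left ?_ (hp0 x y)
    simp only [hcdef]
    split_ifs <;> simp
  set κ : X → X → ℝ :=
    fun x y => (1 - γ) * (p x y * if ρ.cost x y ≤ ENNReal.ofReal (1 / γ) then 1 else 0) with hκdef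
  have hκ0 : ∀ x y, 0 ≤ κ x y := by
    intro x y
    have := hp0 x y
    simp only [hκdef]
    refine mul_nonneg (by linarith) ?_
    split_ifs <;> simp [this]
  have hκp : ∀ x y, κ x y ≤ p x y := by
    intro x y
    have := hp0 x y
    simp only [hκdef]
    split_ifs <;> nlinarith
  have hκD : ∀ x, ∑ y, κ x y ≤ (D x).toReal := fun x =>
    (Finset.sum_le_sum fun y _ => hκp x y).trans_eq (hpD x)
  have hκ1 : 1 - ∑ x, ∑ y, κ x y ≤ 2 * γ := by
    have h1 : ∀ x y, p x y * (if ρ.cost x y ≤ ENNReal.ofReal (1 / γ) then 1 else 0) =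
        p x y - p x y * (if ρ.cost x y ≤ ENNReal.ofReal (1 / γ) then 0 else 1) := by
      intro x y; split_ifs <;> ring
    simp only [hκdef, h1, ← Finset.mul_sum, Finset.sum_sub_distrib, hp1]
    have h2 : 0 ≤ ∑ x, ∑ y, p x y * (if ρ.cost x y ≤ ENNReal.ofReal (1 / γ) then 0 else 1) := by
      refine Finset.sum_nonneg fun x _ => Finset.sum_nonneg fun y _ => ?_
      have := hp0 x y
      split_ifs <;> simp [this]
    nlinarith
  set q := completeDiag (fun x => (D x).toReal) κ with hq
  have hq0 := completeDiag_nonneg hκ0 hκD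
  have hqD := sum_completeDiag_right (fun x => (D x).toReal) κ
  have hdiag : ∀ x, c x x = 0 := by intro x; simp [hcdef, ρ.cost_self]
  have hqc : ∀ x y, 0 < q x y → ρ.cost x y = ENNReal.ofReal (c x y) := by
    intro x y hxy
    by_cases h : x = y
    · rw [h, ρ.cost_self, hdiag, ENNReal.ofReal_zero]
    · rw [hq, completeDiag_of_ne _ _ h] at hxy
      have h1 : ρ.cost x y ≤ ENNReal.ofReal (1 / γ) := by
        by_contra h2
        simp only [hκdef, h2, if_false, mul_zero, lt_self_iff_false] at hxy
      simp only [hcdef, h1, if_true]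
      rw [ENNReal.ofReal_toReal (h1.trans_lt ENNReal.ofReal_lt_top).ne]
  have hmean : ∑ x, ∑ y, q x y * c x y ≤ 1 - γ := by
    have h1 : ∀ x y, q x y * c x y = (1 - γ) * (p x y * c x y) := by
      intro x y
      by_cases h : x = y
      · rw [h, hdiag]; simp
      · rw [hq, completeDiag_of_ne _ _ h]
        simp only [hκdef, hcdef]
        split_ifs <;> ring
    simp only [h1, ← Finset.mul_sum]
    exact mul_le_of_le_one_right (by linarith) hpc
  have hq1 : ∑ y, ∑ x, q x y = 1 := by
    rw [Finset.sum_comm, sum_sum_completeDiag, sum_toReal_pmf]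
  have hlip := sum_prod_mul_accept_le (fun y => Finset.sum_nonneg fun x _ => hp0 x y)
    (by rw [Finset.sum_comm, hp1]) (fun y => Finset.sum_nonneg fun x _ => hq0 x y) hq1 f
  have hL1 := sum_abs_completeDiag_sub_le hκD hκp (sum_toReal_pmf D) hp1
  have hmain := sum_prod_mul_accept_le_adaptiveMax (ρ := ρ) (D := D) hq0 hqD hc0
    (by positivity : 0 ≤ 1 / γ) hγ hcK hqc hmean hm F
  rw [sum_prod_mul_accept_subsample hnm hF hq1] at hmain
  have h3 : (1 / γ) / (γ ^ 2 * m) = 1 / (γ ^ 3 * m) := by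
    have : (m : ℝ) ≠ 0 := by exact_mod_cast hm.ne'
    field_simp
  rw [h3] at hmain
  simp only [expect, iid_toReal, hpsnd]
  have h4 := mul_le_mul_of_nonneg_left (hL1.trans (by linarith : _ ≤ 4 * γ)) (Nat.cast_nonneg n)
  linarith

end ObliviousLeAdaptive
/-! ### Exchangeable sequences of pairs -/

section Exchangeable

variable {Ω X : Type*} {m : ℕ}

/-- The sequence of pairs `(S i, Z i)` of random variables is exchangeable: every transposition of
indices is induced by a weight-preserving bijection of the probability space. -/
def Exchangeable (w : Ω → ℝ) (S Z : Fin m → Ω → X) : Prop :=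
  ∀ i j : Fin m, ∃ e : Ω ≃ Ω, (∀ ω, w (e ω) = w ω) ∧
    ∀ k ω, S k (e ω) = S (Equiv.swap i j k) ω ∧ Z k (e ω) = Z (Equiv.swap i j k) ω

/-- The first `t` variables of the sequence `Z`. -/
def initial (Z : Fin m → Ω → X) (t : ℕ) (ω : Ω) : {i : Fin m // (i : ℕ) < t} → X :=
  fun i => Z i ω

lemma Exchangeable.exists_equiv {w : Ω → ℝ} {S Z : Fin m → Ω → X} (h : Exchangeable w S Z) {t : ℕ}
    {i j : Fin m} (hi : t ≤ i) (hj : t ≤ j) : ∃ e : Ω ≃ Ω, (∀ ω, w (e ω) = w ω) ∧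
      ∀ ω, initial Z t (e ω) = initial Z t ω ∧ S i (e ω) = S j ω ∧ Z i (e ω) = Z j ω := by
  obtain ⟨e, he, hk⟩ := h i j
  refine ⟨e, he, fun ω => ⟨?_, ?_, ?_⟩⟩
  · funext ⟨k, hkt⟩
    have h1 : k ≠ i := by rintro rfl; omega
    have h2 : k ≠ j := by rintro rfl; omega
    simp only [initial, (hk k ω).2, Equiv.swap_apply_of_ne_of_ne h1 h2]
  · rw [(hk i ω).1, Equiv.swap_apply_left]
  · rw [(hk i ω).2, Equiv.swap_apply_left]

variable [Fintype Ω] {w : Ω → ℝ}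

lemma entropy_initial_mono (hw : ∀ ω, 0 ≤ w ω) (Z : Fin m → Ω → X) :
    Monotone fun t => entropy w (initial Z t) := by
  intro s t hst
  refine entropy_le_of_ker hw fun ω ω' h => ?_
  funext ⟨i, hi⟩
  exact congrFun h ⟨i, hi.trans_le hst⟩

lemma entropy_initial_le [Fintype X] (hw : ∀ ω, 0 ≤ w ω) (hw1 : ∑ ω, w ω = 1)
    (Z : Fin m → Ω → X) (t : ℕ) :
    entropy w (initial Z t) ≤ t * Real.log (Fintype.card X) := by
  refine (entropy_le_log_card hw hw1 _).trans ?_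
  rw [Fintype.card_fun, Nat.cast_pow, Real.log_pow]
  refine mul_le_mul_of_nonneg_right ?_ (Real.log_natCast_nonneg _)
  have h : Fintype.card {i : Fin m // (i : ℕ) < t} ≤ Fintype.card (Fin t) :=
    Fintype.card_le_of_injective (fun i => ⟨i.1, i.2⟩) fun i j hij => by
      simpa [Fin.ext_iff, Subtype.ext_iff] using hij
  rw [Fintype.card_fin] at h
  exact_mod_cast h

/-- Summed over `t < R`, the total correlations of the blocks `Z t, …, Z (t + n - 1)` given the
past telescope to at most `n ^ 2 * log |X|`, so one of them is at most the average. -/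
lemma exists_small_total_correlation [Fintype X] (hw : ∀ ω, 0 ≤ w ω) (hw1 : ∑ ω, w ω = 1)
    (Z : Fin m → Ω → X) (n : ℕ) {R : ℕ} (hR : 0 < R) :
    ∃ t < R, entropy w (initial Z t) +
        n * (entropy w (initial Z (t + 1)) - entropy w (initial Z t)) -
        entropy w (initial Z (t + n)) ≤ n ^ 2 * Real.log (Fintype.card X) / R := by
  have hmono := entropy_initial_mono hw Z
  have hle := entropy_initial_le hw hw1 Z
  have hlog : 0 ≤ Real.log (Fintype.card X) := Real.log_natCast_nonneg _
  generalize Real.log (Fintype.card X) = L at *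
  have h0 : 0 ≤ entropy w (initial Z 0) := by
    refine le_of_eq ?_
    have h1 : ∀ ω ω', initial Z 0 ω' = initial Z 0 ω := by
      intro ω ω'; funext ⟨i, hi⟩; omega
    have h2 : ∀ ω, law w (initial Z 0) (initial Z 0 ω) = 1 := fun ω =>
      (Finset.sum_congr rfl fun ω' _ => if_pos (h1 ω ω')).trans hw1
    simp [entropy, h2]
  generalize hH : (fun t => entropy w (initial Z t)) = H at hmono
  have hH' : ∀ t, entropy w (initial Z t) = H t := fun t => congrFun hH t
  simp only [hH'] at *
  have hdiff : ∀ k ≤ n, k * H R - k * (n * L) ≤ ∑ t ∈ Finset.range R, (H (t + k) - H t) := by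
    intro k
    induction k with
    | zero => intro _; simp
    | succ k ih =>
      intro hk
      have h2 : ∑ t ∈ Finset.range R, (H (t + (k + 1)) - H t) =
          ∑ t ∈ Finset.range R, (H (t + k) - H t) + (H (R + k) - H k) := by
        have h3 := Finset.sum_range_sub (fun t => H (t + k)) R
        rw [zero_add] at h3
        rw [← h3, ← Finset.sum_add_distrib]
        refine Finset.sum_congr rfl fun t _ => ?_
        rw [show t + 1 + k = t + (k + 1) by ring]
        ring
      have h4 := hmono (Nat.le_add_right R k)
      have h5 : H k ≤ n * L := (hle k).trans
        (mul_le_mul_of_nonneg_right (by exact_mod_cast (Nat.le_succ k).trans hk) hlog)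
      rw [h2]
      push_cast
      linarith [ih (Nat.le_of_succ_le hk)]
  -- If every term exceeded the average bound, so would the sum.
  by_contra! hcon
  have hsum := Finset.sum_lt_sum_of_nonempty (s := Finset.range R) ⟨0, by simpa using hR⟩
    fun t ht => hcon t (Finset.mem_range.1 ht)
  have h6 : ∑ t ∈ Finset.range R, (H t + n * (H (t + 1) - H t) - H (t + n)) =
      n * (H R - H 0) - ∑ t ∈ Finset.range R, (H (t + n) - H t) := by
    rw [← Finset.sum_range_sub, Finset.mul_sum, ← Finset.sum_sub_distrib]
    exact Finset.sum_congr rfl fun t _ => by ring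
  have hR' : (0 : ℝ) < R := by exact_mod_cast hR
  rw [h6, Finset.sum_const, Finset.card_range, nsmul_eq_mul, mul_div_cancel₀ _ hR'.ne'] at hsum
  have h7 := hdiff n le_rfl
  have h8 := mul_nonneg (Nat.cast_nonneg (α := ℝ) n) h0
  nlinarith

/-- Given the first `t` variables, the next `n` variables behave up to their total correlation like
independent draws from the conditional law of the next variable. -/
lemma sum_mul_block_le [Fintype X] (hw : ∀ ω, 0 ≤ w ω) (hw1 : ∑ ω, w ω = 1)
    {S Z : Fin m → Ω → X} (hex : Exchangeable w S Z) {n t : ℕ} (htm : t < m) (hnm : t + n ≤ m)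
    (f : Algorithm X n Bool) {δ : ℝ}
    (hδ : entropy w (initial Z t) +
        n * (entropy w (initial Z (t + 1)) - entropy w (initial Z t)) -
        entropy w (initial Z (t + n)) ≤ δ) :
    ∑ ω, w ω * f.accept (fun j => Z ⟨t + j, by omega⟩ ω) ≤
      ∑ τ, law w (initial Z t) τ * ∑ v : Fin n → X,
        (∏ j, law w (fun ω => (initial Z t ω, Z ⟨t, htm⟩ ω)) (τ, v j) / law w (initial Z t) τ) *
          f.accept v + 2 * √δ := by
  set T := initial Z t with hT
  set V : Fin n → Ω → X := fun j => Z ⟨t + j, by omega⟩ with hV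
  have hswap : ∀ j : Fin n, ∃ e : Ω ≃ Ω, (∀ ω, w (e ω) = w ω) ∧
      (fun ω => (T ω, V j ω)) = fun ω => (fun ω => (T ω, Z ⟨t, htm⟩ ω)) (e ω) := by
    intro j
    obtain ⟨e, he, hk⟩ := hex.exists_equiv (t := t) (i := ⟨t, htm⟩)
      (j := ⟨t + j, by omega⟩) le_rfl (by simp)
    refine ⟨e, he, ?_⟩
    funext ω
    simp only [hT, hV, (hk ω).1, (hk ω).2.2]
  have hlaw : ∀ j, law w (fun ω => (T ω, V j ω)) = law w fun ω => (T ω, Z ⟨t, htm⟩ ω) := by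
    intro j
    obtain ⟨e, he, h⟩ := hswap j
    rw [h]
    funext a
    exact law_comp_equiv e he (fun ω => (T ω, Z ⟨t, htm⟩ ω)) a
  have hent : ∀ j, entropy w (fun ω => (T ω, V j ω)) ≤ entropy w (initial Z (t + 1)) := by
    intro j
    obtain ⟨e, he, h⟩ := hswap j
    rw [h, entropy_comp_equiv e he fun ω => (T ω, Z ⟨t, htm⟩ ω)]
    refine entropy_le_of_ker hw fun ω ω' h => Prod.ext ?_ ?_
    · funext ⟨i, hi⟩
      exact congrFun h ⟨i, hi.trans (Nat.lt_succ_self t)⟩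
    · exact congrFun h ⟨⟨t, htm⟩, Nat.lt_succ_self t⟩
  have hentB : entropy w (initial Z (t + n)) ≤ entropy w fun ω => (T ω, fun j => V j ω) := by
    refine entropy_le_of_ker hw fun ω ω' h => ?_
    rw [Prod.mk.injEq] at h
    funext ⟨i, hi⟩
    by_cases hit : (i : ℕ) < t
    · exact congrFun h.1 ⟨i, hit⟩
    · have h1 := congrFun h.2 ⟨i - t, by omega⟩
      have h2 : (⟨t + (i - t), by omega⟩ : Fin m) = i := Fin.ext (by simp; omega)
      simpa [hV, h2, initial] using h1
  have hpin := sq_sum_abs_law_sub_prod_le hw hw1 T V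
  simp only [hlaw] at hpin
  have hsum : ∑ j, (entropy w (fun ω => (T ω, V j ω)) - entropy w T) ≤
      n * (entropy w (initial Z (t + 1)) - entropy w T) := by
    refine (Finset.sum_le_sum fun j _ => sub_le_sub_right (hent j) _).trans_eq ?_
    simp [mul_sub]
  have hL1 := Real.le_sqrt_of_sq_le (hpin.trans (by linarith : _ ≤ 4 * δ))
  rw [Real.sqrt_mul (by norm_num), show √(4 : ℝ) = 2 by
    rw [show (4 : ℝ) = 2 ^ 2 by norm_num, Real.sqrt_sq (by norm_num)]] at hL1
  have h1 : ∑ ω, w ω * f.accept (fun j => V j ω) =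
      ∑ y, law w (fun ω => (T ω, fun j => V j ω)) y * f.accept y.2 :=
    (sum_law_mul w (fun ω => (T ω, fun j => V j ω)) fun y => f.accept y.2).symm
  have h2 : ∑ τ, law w T τ * ∑ v : Fin n → X,
      (∏ j, law w (fun ω => (T ω, Z ⟨t, htm⟩ ω)) (τ, v j) / law w T τ) * f.accept v =
      ∑ y : ({i : Fin m // (i : ℕ) < t} → X) × (Fin n → X), (law w T y.1 *
        ∏ j, law w (fun ω => (T ω, Z ⟨t, htm⟩ ω)) (y.1, y.2 j) / law w T y.1) *
          f.accept y.2 := by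
    rw [Fintype.sum_prod_type]
    simp only [Finset.mul_sum, mul_assoc]
  rw [h2]
  refine h1.trans_le (le_trans ?_ (add_le_add_right hL1 _))
  rw [← Finset.sum_add_distrib]
  refine Finset.sum_le_sum fun y _ => ?_
  generalize law w (fun ω => (T ω, fun j => V j ω)) y = a
  generalize law w T y.1 *
    ∏ j, law w (fun ω => (T ω, Z ⟨t, htm⟩ ω)) (y.1, y.2 j) / law w T y.1 = b
  nlinarith [le_abs_self (a - b), abs_nonneg (a - b), f.accept_nonneg y.2, f.accept_le_one y.2]

/-- The first `t` variables of `Z` carry at most `t * log |X|` nats of information. If the `S i` are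
independent, this is shared by the `m - t` remaining ones, so that each of them is almost
independent of the first `t` variables of `Z`. -/
lemma sum_abs_law_initial_sub_le [Fintype X] (hw : ∀ ω, 0 ≤ w ω) (hw1 : ∑ ω, w ω = 1)
    {S Z : Fin m → Ω → X} (hex : Exchangeable w S Z) {t : ℕ} (htm : t < m) {d : X → ℝ}
    (hSi : ∀ i x, law w (S i) x = d x)
    (hS : ∀ v, law w (fun ω (i : {i : Fin m // t ≤ i}) => S i ω) v = ∏ i, d (v i)) :
    ∑ τ, ∑ x, |law w (fun ω => (initial Z t ω, S ⟨t, htm⟩ ω)) (τ, x) -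
        law w (initial Z t) τ * d x| ≤
      2 * √(t * Real.log (Fintype.card X) / (m - t)) := by
  set T := initial Z t with hT
  have hd : ∀ x, 0 ≤ d x := fun x => hSi ⟨t, htm⟩ x ▸ law_nonneg hw _ _
  have hd1 : ∑ x, d x = 1 := by
    rw [← hw1, ← sum_law w (S ⟨t, htm⟩)]
    simp only [hSi]
  have hcard : (Fintype.card {i : Fin m // t ≤ i} : ℝ) = m - t := by
    rw [← Nat.cast_sub htm.le]
    congr 1
    rw [Fintype.card_subtype]
    have h := Fin.card_Ici (⟨t, htm⟩ : Fin m)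
    rw [← h]
    congr 1
    ext i
    simp [Fin.le_def]
  have hent : ∀ i : {i : Fin m // t ≤ i},
      entropy w (fun ω => (T ω, S i ω)) = entropy w fun ω => (T ω, S ⟨t, htm⟩ ω) := by
    rintro ⟨i, hi⟩
    obtain ⟨e, he, hk⟩ := hex.exists_equiv (t := t) (i := ⟨t, htm⟩) (j := i) le_rfl hi
    rw [← entropy_comp_equiv e he fun ω => (T ω, S ⟨t, htm⟩ ω)]
    simp only [hT, (hk _).1, (hk _).2.1]
  -- The entropy of the independent block is the sum of the entropies.
  have hblock : entropy w (fun ω (i : {i : Fin m // t ≤ i}) => S i ω) =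
      (m - t) * entropy w (S ⟨t, htm⟩) := by
    have h1 : ∀ ω, w ω * Real.log (∏ i : {i : Fin m // t ≤ i}, d (S i ω)) =
        ∑ i : {i : Fin m // t ≤ i}, w ω * Real.log (d (S i ω)) := by
      intro ω
      rcases (hw ω).eq_or_lt with h0 | h0
      · simp [← h0]
      · rw [Real.log_prod, Finset.mul_sum]
        intro i _
        rw [← hSi i]
        exact (h0.trans_le (le_law hw (S i) ω)).ne'
    have h2 : ∀ i, ∑ ω, w ω * Real.log (d (S i ω)) = ∑ x, d x * Real.log (d x) := by
      intro i
      rw [← sum_law_mul w (S i) fun x => Real.log (d x)]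
      simp only [hSi]
    simp only [entropy, hS, hSi, h1]
    rw [Finset.sum_comm]
    simp only [h2, Finset.sum_const, Finset.card_univ, nsmul_eq_mul, hcard]
    ring
  have hpin := sq_sum_abs_law_sub_prod_le hw hw1 T fun (i : {i : Fin m // t ≤ i}) => S i
  have hnn := (sq_nonneg _).trans hpin
  simp only [hent, Finset.sum_const, Finset.card_univ, nsmul_eq_mul, hcard] at hnn
  have hmono : entropy w (fun ω (i : {i : Fin m // t ≤ i}) => S i ω) ≤
      entropy w fun ω => (T ω, fun i : {i : Fin m // t ≤ i} => S i ω) :=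
    entropy_le_of_ker hw fun ω ω' h => (Prod.ext_iff.1 h).2
  have hpos : (0 : ℝ) < m - t := sub_pos.2 (by exact_mod_cast htm)
  have hinfo : entropy w (S ⟨t, htm⟩) + entropy w T - entropy w (fun ω => (T ω, S ⟨t, htm⟩ ω)) ≤
      t * Real.log (Fintype.card X) / (m - t) := by
    rw [le_div_iff₀ hpos]
    have h := entropy_initial_le hw hw1 Z t
    rw [← hT] at h
    nlinarith
  have hmi := sq_sum_abs_law_sub_le hw hw1 (fun ω => (T ω, S ⟨t, htm⟩ ω))
    (q := fun y => law w T y.1 * d y.2) (fun y => mul_nonneg (law_nonneg hw _ _) (hd _))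
    (by
      rw [Fintype.sum_prod_type]
      simp only [← Finset.mul_sum, hd1, mul_one, sum_law, hw1, le_refl])
    (fun ω h0 => mul_pos (h0.trans_le (le_law hw T ω))
      (hSi ⟨t, htm⟩ _ ▸ h0.trans_le (le_law hw (S ⟨t, htm⟩) ω)))
  have hkl : ∑ ω, w ω * (Real.log (law w (fun ω => (T ω, S ⟨t, htm⟩ ω)) (T ω, S ⟨t, htm⟩ ω)) -
      Real.log (law w T (T ω) * d (S ⟨t, htm⟩ ω))) =
      entropy w (S ⟨t, htm⟩) + entropy w T - entropy w (fun ω => (T ω, S ⟨t, htm⟩ ω)) := by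
    simp only [entropy, ← Finset.sum_neg_distrib, ← Finset.sum_add_distrib,
      ← Finset.sum_sub_distrib]
    refine Finset.sum_congr rfl fun ω _ => ?_
    rcases (hw ω).eq_or_lt with h0 | h0
    · simp [← h0]
    · rw [← hSi ⟨t, htm⟩, Real.log_mul (h0.trans_le (le_law hw T ω)).ne'
        (h0.trans_le (le_law hw (S ⟨t, htm⟩) ω)).ne']
      ring
  rw [hkl] at hmi
  have hL1 := Real.le_sqrt_of_sq_le (hmi.trans (mul_le_mul_of_nonneg_left hinfo (by norm_num)))
  rw [Real.sqrt_mul (by norm_num), show √(4 : ℝ) = 2 by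
    rw [show (4 : ℝ) = 2 ^ 2 by norm_num, Real.sqrt_sq (by norm_num)],
    Fintype.sum_prod_type] at hL1
  exact hL1

lemma sum_ofReal_law_mul [Fintype X] {β : Type*} [DecidableEq β] (hw : ∀ ω, 0 ≤ w ω)
    (T : Ω → β) (U V : Ω → X)
    (τ : β) (g : X → X → ℝ≥0∞) :
    ∑ x, ∑ y, ENNReal.ofReal (law w (fun ω => (T ω, (U ω, V ω))) (τ, (x, y))) * g x y =
      ∑ ω, if T ω = τ then ENNReal.ofReal (w ω) * g (U ω) (V ω) else 0 := by
  classical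
  have h1 : ∀ x y, ENNReal.ofReal (law w (fun ω => (T ω, (U ω, V ω))) (τ, (x, y))) * g x y =
      ∑ ω, if T ω = τ then (if U ω = x then
        (if V ω = y then ENNReal.ofReal (w ω) * g x y else 0) else 0) else 0 := by
    intro x y
    rw [law, ENNReal.ofReal_sum_of_nonneg fun ω _ => by split_ifs <;> simp [hw],
      Finset.sum_mul]
    refine Finset.sum_congr rfl fun ω _ => ?_
    by_cases h1 : T ω = τ <;> by_cases h2 : U ω = x <;> by_cases h3 : V ω = y <;>
      simp [h1, h2, h3]
  simp only [h1]
  rw [Finset.sum_congr rfl fun x _ => Finset.sum_comm, Finset.sum_comm]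
  refine Finset.sum_congr rfl fun ω _ => ?_
  by_cases h : T ω = τ <;> simp [h]

/-- If the total cost of moving the sequence `S` to `Z` never exceeds `m`, then given the first `t`
variables of `Z` the expected cost at the next index is at most `m / (m - t)`: the remaining `m - t`
indices have the same expected cost. -/
lemma sum_conditional_cost_le [Fintype X] (hw : ∀ ω, 0 ≤ w ω)
    {S Z : Fin m → Ω → X} (hex : Exchangeable w S Z) {t : ℕ} (htm : t < m) {ρ : CostFunction X}
    (hcost : ∀ ω, ∑ i, ρ.cost (S i ω) (Z i ω) ≤ m) (τ : {i : Fin m // (i : ℕ) < t} → X) :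
    ((m - t : ℕ) : ℝ≥0∞) * ∑ x, ∑ y, ENNReal.ofReal
        (law w (fun ω => (initial Z t ω, (S ⟨t, htm⟩ ω, Z ⟨t, htm⟩ ω))) (τ, (x, y))) *
          ρ.cost x y ≤
      m * ENNReal.ofReal (law w (initial Z t) τ) := by
  classical
  set T := initial Z t with hT
  rw [sum_ofReal_law_mul hw]
  have hcard : (m - t : ℕ) = Fintype.card {i : Fin m // t ≤ i} := by
    rw [Fintype.card_subtype, ← Fin.card_Ici (⟨t, htm⟩ : Fin m)]
    congr 1
    ext i
    simp [Fin.le_def]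
  have heq : ∀ i : {i : Fin m // t ≤ i},
      (∑ ω, if T ω = τ then ENNReal.ofReal (w ω) * ρ.cost (S i ω) (Z i ω) else 0) =
      ∑ ω, if T ω = τ then
        ENNReal.ofReal (w ω) * ρ.cost (S ⟨t, htm⟩ ω) (Z ⟨t, htm⟩ ω) else 0 := by
    rintro ⟨i, hi⟩
    obtain ⟨e, he, hk⟩ := hex.exists_equiv (t := t) (i := ⟨t, htm⟩) (j := i) le_rfl hi
    rw [← Equiv.sum_comp e fun ω => if T ω = τ then
        ENNReal.ofReal (w ω) * ρ.cost (S ⟨t, htm⟩ ω) (Z ⟨t, htm⟩ ω) else 0]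
    simp only [hT, (hk _).1, (hk _).2.1, (hk _).2.2, he]
  rw [hcard, ← nsmul_eq_mul, ← Finset.card_univ, ← Finset.sum_const]
  refine (Finset.sum_congr rfl fun i _ => (heq i).symm).trans_le ?_
  rw [Finset.sum_comm, law, ENNReal.ofReal_sum_of_nonneg fun ω _ => by split_ifs <;> simp [hw],
    Finset.mul_sum]
  refine Finset.sum_le_sum fun ω _ => ?_
  by_cases h : T ω = τ
  · simp only [h, if_true]
    rw [← Finset.mul_sum, mul_comm]
    refine mul_le_mul_left ((le_trans ?_ (hcost ω))) _
    refine le_trans (le_of_eq ?_) (Finset.sum_le_sum_of_subset (Finset.subset_univ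
      (Finset.univ.map (Function.Embedding.subtype fun i : Fin m => t ≤ (i : ℕ)))))
    rw [Finset.sum_map]
    rfl
  · simp [h]

end Exchangeable
/-! ### The oblivious adversary simulates the adaptive one -/

section AdaptiveLeOblivious

variable {X : Type*} [Fintype X]

/-- Conditionally on a value `τ` of the first `t` variables of `Z`, the pair `(S t, Z t)` is almost
a legal corruption of `D`: scaling its law by `1 - t / m` brings the cost below `1`, and cutting it
down where the law of `S t` exceeds `D` makes it a partial coupling starting from `D`. -/
lemma sum_conditional_prod_mul_accept_le {Ω : Type*} [Fintype Ω] {w : Ω → ℝ} (hw : ∀ ω, 0 ≤ w ω)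
    {m n t : ℕ} {S Z : Fin m → Ω → X} (hex : Exchangeable w S Z) (htm : t < m)
    {ρ : CostFunction X} (hcost : ∀ ω, ∑ i, ρ.cost (S i ω) (Z i ω) ≤ m) (D : PMF X)
    (f : Algorithm X n Bool) (τ : {i : Fin m // (i : ℕ) < t} → X) :
    law w (initial Z t) τ * ∑ v : Fin n → X,
        (∏ j, law w (fun ω => (initial Z t ω, Z ⟨t, htm⟩ ω)) (τ, v j) / law w (initial Z t) τ) *
          f.accept v ≤
      law w (initial Z t) τ * (obliviousMax ρ f D + n * (2 * (t / m))) +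
        n * (2 * ∑ x, |law w (fun ω => (initial Z t ω, S ⟨t, htm⟩ ω)) (τ, x) -
          law w (initial Z t) τ * (D x).toReal|) := by
  classical
  set T := initial Z t with hT
  set p0 := law w T τ with hp0
  set dS : X → ℝ := fun x => law w (fun ω => (T ω, S ⟨t, htm⟩ ω)) (τ, x) with hdS
  set P : X → X → ℝ :=
    fun x y => law w (fun ω => (T ω, (S ⟨t, htm⟩ ω, Z ⟨t, htm⟩ ω))) (τ, (x, y)) with hP
  have hp0' : 0 ≤ p0 := law_nonneg hw _ _
  rcases hp0'.eq_or_lt with h0 | h0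
  · rw [← h0, zero_mul, zero_mul, zero_add]
    positivity
  have hP0 : ∀ x y, 0 ≤ P x y := fun x y => law_nonneg hw _ _
  have hPS : ∀ x, ∑ y, P x y = dS x := by
    intro x
    simp only [hP, hdS, law, Prod.mk.injEq]
    rw [Finset.sum_comm]
    refine Finset.sum_congr rfl fun ω _ => ?_
    by_cases h1 : T ω = τ <;> by_cases h2 : S ⟨t, htm⟩ ω = x <;> simp [h1, h2]
  have hPZ : ∀ y, ∑ x, P x y = law w (fun ω => (T ω, Z ⟨t, htm⟩ ω)) (τ, y) := by
    intro y
    simp only [hP, law, Prod.mk.injEq]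
    rw [Finset.sum_comm]
    refine Finset.sum_congr rfl fun ω _ => ?_
    by_cases h1 : T ω = τ <;> by_cases h2 : Z ⟨t, htm⟩ ω = y <;> simp [h1, h2]
  have hdS1 : ∑ x, dS x = p0 := sum_law_prod w T _ τ
  have hdS0 : ∀ x, 0 ≤ dS x := fun x => law_nonneg hw _ _
  have hm : (0 : ℝ) < m := by exact_mod_cast (Nat.zero_le t).trans_lt htm
  have htm' : (t : ℝ) ≤ m := by exact_mod_cast htm.le
  set θ : ℝ := (m - t) / m with hθ
  have hθ0 : 0 ≤ θ := div_nonneg (sub_nonneg.2 htm') hm.le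
  have hθt : θ = 1 - t / m := by rw [hθ, sub_div, div_self hm.ne']
  have hθ1 : θ ≤ 1 := by rw [hθt]; linarith [div_nonneg (Nat.cast_nonneg (α := ℝ) t) hm.le]
  set d : X → ℝ := fun x => (D x).toReal with hd
  have hd0 : ∀ x, 0 ≤ d x := fun x => ENNReal.toReal_nonneg
  -- The fraction of the mass at `x` that is kept. Where `dS x = 0` its value does not matter.
  set a : X → ℝ := fun x => θ * min 1 (p0 * d x / dS x) with ha
  have hmin0 : ∀ x, 0 ≤ min 1 (p0 * d x / dS x) := fun x =>
    le_min zero_le_one (div_nonneg (mul_nonneg hp0' (hd0 x)) (hdS0 x))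
  have ha0 : ∀ x, 0 ≤ a x := fun x => mul_nonneg hθ0 (hmin0 x)
  have haθ : ∀ x, a x ≤ θ := fun x => mul_le_of_le_one_right hθ0 (min_le_left _ _)
  have hadS : ∀ x, a x * dS x = θ * min (dS x) (p0 * d x) := by
    intro x
    rcases (hdS0 x).eq_or_lt with h | h
    · rw [← h, min_eq_left (mul_nonneg hp0' (hd0 x))]; simp
    · rw [ha]
      dsimp only
      rw [mul_assoc, min_mul_of_nonneg _ _ h.le, one_mul, div_mul_cancel₀ _ h.ne']
  have key := sum_prod_mul_accept_le_obliviousMax_add (ρ := ρ) (D := D)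
    (κ := fun x y => a x / p0 * P x y) (π := fun x y => P x y / p0)
    (fun x y => mul_nonneg (div_nonneg (ha0 x) hp0') (hP0 x y))
    (fun x => by
      rw [← Finset.mul_sum, hPS, div_mul_eq_mul_div, hadS, div_le_iff₀ h0, mul_comm _ p0]
      exact (mul_le_of_le_one_left (le_min (hdS0 x) (mul_nonneg hp0' (hd0 x))) hθ1).trans
        (min_le_right _ _))
    (fun x y => by
      rw [div_mul_eq_mul_div]
      exact div_le_div_of_nonneg_right
        (mul_le_of_le_one_left (hP0 x y) ((haθ x).trans hθ1)) hp0')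
    (by simp only [← Finset.sum_div, hPS, hdS1, div_self h0.ne'])
    (by
      have hc := sum_conditional_cost_le hw hex htm hcost τ
      rw [← hT, ← hp0] at hc
      have h1 : ∑ x, ∑ y, ENNReal.ofReal (a x / p0 * P x y) * ρ.cost x y ≤
          ENNReal.ofReal (θ / p0) * ∑ x, ∑ y, ENNReal.ofReal (P x y) * ρ.cost x y := by
        simp only [Finset.mul_sum]
        refine Finset.sum_le_sum fun x _ => Finset.sum_le_sum fun y _ => ?_
        rw [ENNReal.ofReal_mul (div_nonneg (ha0 x) hp0'), mul_assoc]
        gcongr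
        exact haθ x
      have h2 : ENNReal.ofReal (θ / p0) =
          ENNReal.ofReal (1 / (m * p0)) * ((m - t : ℕ) : ℝ≥0∞) := by
        rw [← ENNReal.ofReal_natCast, ← ENNReal.ofReal_mul (by positivity),
          Nat.cast_sub htm.le, hθ]
        congr 1
        field_simp
      refine h1.trans ?_
      rw [h2, mul_assoc]
      refine (mul_le_mul_right hc _).trans_eq ?_
      rw [← ENNReal.ofReal_natCast, ← ENNReal.ofReal_mul hm.le,
        ← ENNReal.ofReal_mul (by positivity), one_div, inv_mul_cancel₀ (by positivity),
        ENNReal.ofReal_one]) f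
  have hloss : p0 * (1 - ∑ x, ∑ y, a x / p0 * P x y) ≤ p0 * (t / m) + ∑ x, |dS x - p0 * d x| := by
    have h1 : p0 * ∑ x, ∑ y, a x / p0 * P x y = ∑ x, θ * min (dS x) (p0 * d x) := by
      rw [Finset.mul_sum]
      refine Finset.sum_congr rfl fun x _ => ?_
      rw [← Finset.mul_sum, hPS, ← hadS]
      field_simp
    have h2 : ∑ x, (θ * dS x - |dS x - p0 * d x|) ≤ ∑ x, θ * min (dS x) (p0 * d x) := by
      refine Finset.sum_le_sum fun x _ => ?_
      rcases le_total (dS x) (p0 * d x) with h | h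
      · rw [min_eq_left h]; linarith [abs_nonneg (dS x - p0 * d x)]
      · rw [min_eq_right h, abs_of_nonneg (sub_nonneg.2 h)]; nlinarith
    rw [Finset.sum_sub_distrib, ← Finset.mul_sum, hdS1] at h2
    rw [mul_sub, h1]
    rw [hθt] at h2 ⊢
    linarith
  simp only [← Finset.sum_div, hPZ] at key
  have h3 := mul_le_mul_of_nonneg_left key hp0'
  have h4 := mul_le_mul_of_nonneg_left hloss
    (mul_nonneg (Nat.cast_nonneg (α := ℝ) n) (by norm_num : (0 : ℝ) ≤ 2))
  refine h3.trans ?_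
  simp only [hdS, hd] at h4
  linarith

/-- A strategy that moves an exchangeable sequence of independent points at average cost at most `1`
gains little over the oblivious adversary when only `n` of the points are tested. -/
lemma sum_mul_accept_le_obliviousMax_add {Ω : Type*} [Fintype Ω] {w : Ω → ℝ} (hw : ∀ ω, 0 ≤ w ω)
    (hw1 : ∑ ω, w ω = 1) {m n R : ℕ} (hR : 0 < R) (hRm : R + n ≤ m) (hRm' : R < m)
    {S Z : Fin m → Ω → X}
    (hex : Exchangeable w S Z) {ρ : CostFunction X}
    (hcost : ∀ ω, ∑ i, ρ.cost (S i ω) (Z i ω) ≤ m) {D : PMF X}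
    (hSi : ∀ i x, law w (S i) x = (D x).toReal)
    (hS : ∀ (t : ℕ) v, law w (fun ω (i : {i : Fin m // t ≤ i}) => S i ω) v = ∏ i, (D (v i)).toReal)
    (f : Algorithm X n Bool) {c : ℝ}
    (hc : ∀ σ : Fin n ↪ Fin m, c ≤ ∑ ω, w ω * f.accept (fun j => Z (σ j) ω)) :
    c ≤ obliviousMax ρ f D + (2 * √(n ^ 2 * Real.log (Fintype.card X) / R) + n * (2 * (R / m)) +
      n * (4 * √(R * Real.log (Fintype.card X) / (m - R)))) := by
  obtain ⟨t, htR, ht⟩ := exists_small_total_correlation hw hw1 Z n hR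
  have htm : t < m := by omega
  have h1 := hc ⟨fun j => ⟨t + j, by omega⟩, fun i j h => by simpa [Fin.ext_iff] using h⟩
  have h2 := sum_mul_block_le hw hw1 hex htm (by omega) f ht
  have h3 := Finset.sum_le_sum fun τ (_ : τ ∈ Finset.univ) =>
    sum_conditional_prod_mul_accept_le hw hex htm hcost D f τ
  have h4 := sum_abs_law_initial_sub_le hw hw1 hex htm hSi (hS t)
  simp only [Finset.sum_add_distrib, ← Finset.sum_mul, ← Finset.mul_sum, sum_law, hw1,
    one_mul] at h3
  have hpos : (0 : ℝ) < m - R := sub_pos.2 (by exact_mod_cast hRm')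
  have htR' : (t : ℝ) ≤ R := by exact_mod_cast htR.le
  have hlog : 0 ≤ Real.log (Fintype.card X) := Real.log_natCast_nonneg _
  have h5 : √(t * Real.log (Fintype.card X) / (m - t)) ≤
      √(R * Real.log (Fintype.card X) / (m - R)) := by
    refine Real.sqrt_le_sqrt (div_le_div₀ (by positivity) ?_ hpos (by linarith))
    exact mul_le_mul_of_nonneg_right htR' hlog
  have h6 : (t : ℝ) / m ≤ R / m := div_le_div_of_nonneg_right htR' (Nat.cast_nonneg m)
  have h7 : (n : ℝ) * (2 * ∑ τ, ∑ x, |law w (fun ω => (initial Z t ω, S ⟨t, htm⟩ ω)) (τ, x) -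
      law w (initial Z t) τ * (D x).toReal|) ≤
      n * (4 * √(R * Real.log (Fintype.card X) / (m - R))) :=
    mul_le_mul_of_nonneg_left (by linarith) (Nat.cast_nonneg n)
  have h8 : (n : ℝ) * (2 * (t / m)) ≤ n * (2 * (R / m)) :=
    mul_le_mul_of_nonneg_left (by linarith) (Nat.cast_nonneg n)
  exact h1.trans (h2.trans (by linarith))

/-- A fixed injection followed by a uniformly random permutation is a uniformly random injection. -/
lemma avg_embedding_eq_avg_perm {n m : ℕ} (ι : Fin n ↪ Fin m) (g : (Fin n ↪ Fin m) → ℝ) :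
    (Fintype.card (Fin n ↪ Fin m) : ℝ)⁻¹ * ∑ σ, g σ =
      (Fintype.card (Equiv.Perm (Fin m)) : ℝ)⁻¹ *
        ∑ σ : Equiv.Perm (Fin m), g (ι.trans σ.toEmbedding) := by
  have hne : Nonempty (Fin n ↪ Fin m) := ⟨ι⟩
  have hN : (Fintype.card (Fin n ↪ Fin m) : ℝ) ≠ 0 := by exact_mod_cast Fintype.card_ne_zero
  have hM : (Fintype.card (Equiv.Perm (Fin m)) : ℝ) ≠ 0 := by exact_mod_cast Fintype.card_ne_zero
  have h1 : ∀ ι' : Fin n ↪ Fin m, ∑ σ : Equiv.Perm (Fin m), g (ι'.trans σ.toEmbedding) =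
      ∑ σ : Equiv.Perm (Fin m), g (ι.trans σ.toEmbedding) := by
    intro ι'
    obtain ⟨π, hπ⟩ := Equiv.Perm.exists_extending_pair ι ι' ι.injective ι'.injective
    rw [← Equiv.sum_comp (Equiv.mulRight π) fun σ : Equiv.Perm (Fin m) =>
      g (ι.trans σ.toEmbedding)]
    refine Finset.sum_congr rfl fun σ _ => congrArg g ?_
    ext j
    simp [hπ]
  have h2 : ∀ σ : Equiv.Perm (Fin m),
      ∑ ι' : Fin n ↪ Fin m, g (ι'.trans σ.toEmbedding) = ∑ ι', g ι' := by
    intro σ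
    exact Equiv.sum_comp (Equiv.embeddingCongr (Equiv.refl _) σ) g
  have h3 : (Fintype.card (Fin n ↪ Fin m) : ℝ) *
      ∑ σ : Equiv.Perm (Fin m), g (ι.trans σ.toEmbedding) =
      Fintype.card (Equiv.Perm (Fin m)) * ∑ ι', g ι' := by
    rw [← nsmul_eq_mul, ← nsmul_eq_mul, ← Finset.card_univ, ← Finset.card_univ,
      ← Finset.sum_const, ← Finset.sum_const]
    rw [← Finset.sum_congr rfl fun ι' _ => h1 ι', ← Finset.sum_congr rfl fun σ _ => h2 σ,
      Finset.sum_comm]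
  field_simp
  linarith

/-- The probability space is a sample `x` together with an independent uniformly random permutation
`σ` of the indices; the latter makes the pairs of original and corrupted points exchangeable,
whatever the strategy of the adaptive adversary. -/
lemma adaptiveMax_le_obliviousMax_add {n m R : ℕ} (hR : 0 < R) (hRm : R + n ≤ m) (hRm' : R < m)
    {f : Algorithm X n Bool} {F : Algorithm X m Bool}
    (hF : ∀ S, F.accept S = (Fintype.card (Fin n ↪ Fin m) : ℝ)⁻¹ *
      ∑ σ : Fin n ↪ Fin m, f.accept (S ∘ σ)) (ρ : CostFunction X) (D : PMF X) :
    adaptiveMax ρ F D ≤ obliviousMax ρ f D + (2 * √(n ^ 2 * Real.log (Fintype.card X) / R) +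
      n * (2 * (R / m)) + n * (4 * √(R * Real.log (Fintype.card X) / (m - R)))) := by
  classical
  have hopt : ∀ x : Fin m → X, ∃ y : sampleCorruptions ρ x,
      F.accept y = ⨆ S' : sampleCorruptions ρ x, F.accept S' := by
    intro x
    have : Nonempty (sampleCorruptions ρ x) := ⟨⟨x, mem_sampleCorruptions_self ρ x⟩⟩
    exact exists_eq_ciSup_of_finite
  choose C hC using hopt
  have hd1 := sum_toReal_pmf D
  have hM : (Fintype.card (Equiv.Perm (Fin m)) : ℝ) ≠ 0 := by exact_mod_cast Fintype.card_ne_zero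
  have hm0 : m ≠ 0 := by omega
  set w : (Fin m → X) × Equiv.Perm (Fin m) → ℝ :=
    fun ω => (∏ i, (D (ω.1 i)).toReal) * (Fintype.card (Equiv.Perm (Fin m)) : ℝ)⁻¹ with hwdef
  have hsumw : ∀ g : (Fin m → X) × Equiv.Perm (Fin m) → ℝ, ∑ ω, w ω * g ω =
      (Fintype.card (Equiv.Perm (Fin m)) : ℝ)⁻¹ *
        ∑ σ : Equiv.Perm (Fin m), ∑ x, (∏ i, (D (x i)).toReal) * g (x, σ) := by
    intro g
    rw [Fintype.sum_prod_type, Finset.sum_comm, Finset.mul_sum]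
    refine Finset.sum_congr rfl fun σ _ => ?_
    rw [Finset.mul_sum]
    exact Finset.sum_congr rfl fun x _ => by simp only [hwdef]; ring
  have hw : ∀ ω, 0 ≤ w ω := fun ω =>
    mul_nonneg (Finset.prod_nonneg fun i _ => ENNReal.toReal_nonneg) (by positivity)
  have hw1 : ∑ ω, w ω = 1 := by
    have h := hsumw fun _ => 1
    simp only [mul_one, sum_prod_weight hd1, Finset.sum_const, Finset.card_univ, nsmul_eq_mul,
      inv_mul_cancel₀ hM] at h
    exact h
  have hlaw : ∀ {κ : Type} [Fintype κ] [DecidableEq κ] (e : κ → Fin m), Function.Injective e →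
      ∀ v : κ → X, law w (fun ω k => ω.1 (ω.2 (e k))) v = ∏ k, (D (v k)).toReal := by
    intro κ _ _ e he v
    have h1 : law w (fun ω k => ω.1 (ω.2 (e k))) v =
        ∑ ω, w ω * (fun u : κ → X => if u = v then 1 else 0) (ω.1 ∘ (ω.2 ∘ e)) := by
      refine Finset.sum_congr rfl fun ω _ => ?_
      rw [mul_ite, mul_one, mul_zero]
      split_ifs with h1 h2 h2
      · rfl
      · exact absurd h1 h2
      · exact absurd h2 h1
      · rfl
    rw [h1, hsumw, Finset.sum_congr rfl fun (σ : Equiv.Perm (Fin m)) _ =>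
      sum_prod_weight_comp hd1 (σ.injective.comp he) fun u : κ → X => if u = v then 1 else 0]
    simp only [mul_ite, mul_one, mul_zero, Finset.sum_ite_eq', Finset.mem_univ, if_true,
      Finset.sum_const, Finset.card_univ, nsmul_eq_mul]
    rw [inv_mul_cancel_left₀ hM]
  refine sum_mul_accept_le_obliviousMax_add hw hw1 hR hRm hRm' (D := D)
    (S := fun i ω => ω.1 (ω.2 i)) (Z := fun i ω => (C ω.1 : Fin m → X) (ω.2 i)) ?_ ?_ ?_ ?_ f ?_
  · intro i j
    refine ⟨Equiv.prodCongr (Equiv.refl _) (Equiv.mulRight (Equiv.swap i j)), fun ω => rfl,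
      fun k ω => ⟨rfl, rfl⟩⟩
  · intro ω
    rw [Equiv.sum_comp ω.2 fun i => ρ.cost (ω.1 i) ((C ω.1 : Fin m → X) i)]
    have h : (m : ℝ≥0∞)⁻¹ * ∑ i, ρ.cost (ω.1 i) ((C ω.1 : Fin m → X) i) ≤ 1 := (C ω.1).2
    rwa [ENNReal.inv_mul_le_iff (by exact_mod_cast hm0) (ENNReal.natCast_ne_top m), mul_one] at h
  · intro i x
    have h := hlaw (fun _ : Unit => i) (fun _ _ _ => Subsingleton.elim _ _) fun _ => x
    simp only [Finset.univ_unique, Finset.prod_singleton] at h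
    rw [← h]
    refine Finset.sum_congr rfl fun ω _ => ?_
    simp [funext_iff]
  · intro t v
    exact hlaw Subtype.val Subtype.val_injective v
  · intro ι
    refine le_of_eq ?_
    rw [hsumw, Finset.sum_comm, Finset.mul_sum]
    simp only [adaptiveMax, expect, iid_toReal]
    refine Finset.sum_congr rfl fun x _ => ?_
    rw [← hC, hF, avg_embedding_eq_avg_perm ι fun σ => f.accept ((C x : Fin m → X) ∘ σ),
      ← Finset.mul_sum, mul_left_comm]
    rfl

end AdaptiveLeOblivious
/-! ### Choice of parameters -/

/-- A sample size sufficient for the equivalence, as a polynomial in `n`, `log |X|` and `1 / ε`.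
Its summands make room for the conditioned variables and bound the errors of the two directions. -/
noncomputable def sampleSizePoly : MvPolynomial (Fin 3) ℝ :=
  let n : MvPolynomial (Fin 3) ℝ := .X 0
  let L : MvPolynomial (Fin 3) ℝ := .X 1
  let e : MvPolynomial (Fin 3) ℝ := .X 2
  (16 * n ^ 2 * L * e ^ 2 + 2) * (1 + 256 * n ^ 2 * L * e ^ 2 + 8 * n * e) + n + 1 +
    1024 * e * (n + 1) ^ 3 * (e + 1) ^ 3

lemma eval_sampleSizePoly (n L e : ℝ) : MvPolynomial.eval ![n, L, e] sampleSizePoly =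
    (16 * n ^ 2 * L * e ^ 2 + 2) * (1 + 256 * n ^ 2 * L * e ^ 2 + 8 * n * e) + n + 1 +
      1024 * e * (n + 1) ^ 3 * (e + 1) ^ 3 := by
  simp [sampleSizePoly]

/-- The error terms of the simulation of the adaptive adversary, with `r` conditioned variables. -/
lemma adaptive_error_le {n L ε r m : ℝ} (hn : 0 ≤ n) (hL : 0 ≤ L) (hε : 0 < ε) (hr : 0 < r)
    (hr1 : 16 * n ^ 2 * L * (1 / ε) ^ 2 ≤ r)
    (hm : r * (1 + 256 * n ^ 2 * L * (1 / ε) ^ 2 + 8 * n * (1 / ε)) < m) :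
    2 * √(n ^ 2 * L / r) + n * (2 * (r / m)) + n * (4 * √(r * L / (m - r))) ≤ ε := by
  have hA : 0 ≤ r * (256 * n ^ 2 * L * (1 / ε) ^ 2) := by positivity
  have hB : 0 ≤ r * (8 * n * (1 / ε)) := by positivity
  have hmr : 0 < m - r := by linarith
  have hm0 : 0 < m := by linarith
  have h1 : √(n ^ 2 * L / r) ≤ ε / 4 := by
    rw [Real.sqrt_le_left (by positivity), div_le_iff₀ hr]
    have h : 16 * n ^ 2 * L * (1 / ε) ^ 2 = (n ^ 2 * L) * (16 / ε ^ 2) := by ring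
    rw [h, mul_div_assoc', div_le_iff₀ (by positivity)] at hr1
    linarith
  have h2 : n * (2 * (r / m)) ≤ ε / 4 := by
    have h : n * (2 * (r / m)) = 2 * n * r / m := by ring
    rw [h, div_le_iff₀ hm0]
    have h3 : r * (8 * n * (1 / ε)) ≤ m := by linarith
    have h4 : r * (8 * n * (1 / ε)) = 8 * n * r / ε := by ring
    rw [h4, div_le_iff₀ hε] at h3
    linarith
  have h3 : n * (4 * √(r * L / (m - r))) ≤ ε / 4 := by
    have h : n * √(r * L / (m - r)) ≤ ε / 16 := by
      rw [← Real.sqrt_sq hn, ← Real.sqrt_mul (sq_nonneg n),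
        Real.sqrt_le_left (by positivity), mul_div_assoc', div_le_iff₀ hmr]
      have h3 : r * (256 * n ^ 2 * L * (1 / ε) ^ 2) ≤ m - r := by linarith
      have h4 : r * (256 * n ^ 2 * L * (1 / ε) ^ 2) = 256 * (n ^ 2 * (r * L)) / ε ^ 2 := by ring
      rw [h4, div_le_iff₀ (by positivity)] at h3
      linarith
    linarith
  linarith

/-- The error terms of the simulation of the oblivious adversary. -/
lemma oblivious_error_le {n ε γ m : ℝ} (hn : 0 ≤ n) (hε : 0 < ε)
    (hγ : γ = 1 / (8 * (n + 1) * (1 / ε + 1)))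
    (hm : 1024 * (1 / ε) * (n + 1) ^ 3 * (1 / ε + 1) ^ 3 < m) :
    n * (4 * γ) + 1 / (γ ^ 3 * m) ≤ ε := by
  have he : 0 < 1 / ε := by positivity
  have hm0 : 0 < m := lt_of_le_of_lt (by positivity) hm
  have h1 : n * (4 * γ) ≤ ε / 2 := by
    rw [hγ, mul_one_div, mul_div_assoc', div_le_iff₀ (by positivity)]
    have h2 : ε / 2 * (8 * (n + 1) * (1 / ε + 1)) = 4 * (n + 1) * (1 + ε) := by
      field_simp; ring
    rw [h2]
    nlinarith
  have h2 : 1 / (γ ^ 3 * m) ≤ ε / 2 := by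
    have h3 : 1 / (γ ^ 3 * m) = 512 * (n + 1) ^ 3 * (1 / ε + 1) ^ 3 / m := by
      rw [hγ]
      field_simp
      ring
    rw [h3, div_le_iff₀ hm0]
    have h4 : 512 * (n + 1) ^ 3 * (1 / ε + 1) ^ 3 =
        ε / 2 * (1024 * (1 / ε) * (n + 1) ^ 3 * (1 / ε + 1) ^ 3) := by
      field_simp; ring
    rw [h4]
    exact mul_le_mul_of_nonneg_left hm.le (by positivity)
  linarith

end Adversary

theorem theorem1 :
    ∃ P : MvPolynomial (Fin 3) ℝ,
      ∀ (X : Type*) [Fintype X] (Y : Type*) (n : ℕ) (A : Adversary.Algorithm X n Y)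
        (ε : ℝ), 0 < ε → ∀ (ρ : Adversary.CostFunction X) (m : ℕ),
        MvPolynomial.eval ![(n : ℝ), Real.log (Fintype.card X), 1 / ε] P ≤ m →
        ∃ h : n ≤ m, Adversary.EpsEquivalent ρ ε A (A.afterSubsample h) := by
  refine ⟨Adversary.sampleSizePoly, fun X _ Y n A ε hε ρ m hm => ?_⟩
  rw [Adversary.eval_sampleSizePoly] at hm
  have hL : 0 ≤ Real.log (Fintype.card X) := Real.log_natCast_nonneg _
  have hn : (0 : ℝ) ≤ n := Nat.cast_nonneg n
  have he : 0 < 1 / ε := by positivity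
  set L := Real.log (Fintype.card X) with hLdef
  set r0 : ℝ := 16 * n ^ 2 * L * (1 / ε) ^ 2 with hr0
  have hr0' : 0 ≤ r0 := by positivity
  set R : ℕ := ⌊r0⌋₊ + 1 with hRdef
  have hR1 : r0 ≤ R := by
    rw [hRdef]; push_cast; exact (Nat.lt_floor_add_one r0).le
  have hR2 : (R : ℝ) ≤ r0 + 2 := by
    rw [hRdef]; push_cast; linarith [Nat.floor_le hr0']
  set q : ℝ := 256 * n ^ 2 * L * (1 / ε) ^ 2 + 8 * n * (1 / ε) with hq
  have hq0 : 0 ≤ q := by positivity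
  have hRq : (R : ℝ) * q ≤ (r0 + 2) * q := mul_le_mul_of_nonneg_right hR2 hq0
  have hRq0 : 0 ≤ (R : ℝ) * q := by positivity
  have hlast : 0 ≤ 1024 * (1 / ε) * (n + 1 : ℝ) ^ 3 * (1 / ε + 1) ^ 3 := by positivity
  have hm' : (r0 + 2) + (r0 + 2) * q + n + 1 +
      1024 * (1 / ε) * (n + 1 : ℝ) ^ 3 * (1 / ε + 1) ^ 3 ≤ m := by
    refine le_trans (le_of_eq ?_) hm
    rw [hq]; ring
  have hRm : R + n ≤ m := by
    have : (R : ℝ) + n ≤ m := by linarith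
    exact_mod_cast this
  have hRm' : R < m := by
    have : (R : ℝ) < m := by linarith
    exact_mod_cast this
  have hnm : n ≤ m := by omega
  refine ⟨hnm, fun T D => abs_sub_le_iff.2 ⟨?_, ?_⟩⟩
  -- `1 / ε + 1` rather than `1 / ε` keeps `γ ≤ 1` also for large `ε`.
  · set γ : ℝ := 1 / (8 * (n + 1) * (1 / ε + 1)) with hγ
    have hγ0 : 0 < γ := by positivity
    have hγ1 : γ ≤ 1 := by
      rw [hγ, div_le_one (by positivity)]
      nlinarith
    have h1 := Adversary.obliviousMax_le_adaptiveMax_add hnm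
      (A.accept_test_afterSubsample hnm T) ρ D hγ0 hγ1 (by omega)
    have h2 := Adversary.oblivious_error_le hn hε hγ
      (m := m) (by linarith [mul_nonneg (by linarith : 0 ≤ r0 + 2) hq0])
    linarith
  · have h1 := Adversary.adaptiveMax_le_obliviousMax_add (Nat.succ_pos _) hRm hRm'
      (A.accept_test_afterSubsample hnm T) ρ D
    have h2 := Adversary.adaptive_error_le hn hL hε (r := R) (m := m)
      (by exact_mod_cast Nat.succ_pos _) hR1 (by
        rw [add_assoc, ← hq, mul_add, mul_one]
        linarith)
    linarith
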